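/- **The calculus.** Linearities are $Y\in\{\bullet,\circ\}$ (unlimited, linear). Types are given by value types $A,B::=\alpha\mid A\to^Y C\mid\forall^Y\alpha^K.C$; computation types $C,D::=A\,!\,E$; effect types $E::=\{R\}$; rows $R::=\ell:P;R\mid\mu\mid\cdot$; presence types $P::=\mathsf{Abs}\mid A\twoheadrightarrow^Y B\mid\theta$; handler types $C\rightrightarrows D$. Kinds are $K::=\mathsf{Type}^Y\mid\mathsf{Row}_{\mathcal L}^Y\mid\mathsf{Presence}^Y\mid\mathsf{Effect}\mid\mathsf{Comp}\mid\mathsf{Handler}$ with $\mathcal L$ a finite set of labels; type variables in types are of kind $\mathsf{Type}$, $\mathsf{Row}$ or $\mathsf{Presence}$. Types are identified up to reordering the distinct labels of a row and dropping labels $\ell:\mathsf{Abs}$ from rows that end in $\cdot$. Terms are $$V,W::=x\mid\lambda^Yx^A.M\mid\Lambda^Y\alpha^K.M\mid\lfloor V\rfloor,\qquad H::=\{\mathsf{return}\,x\mapsto M\}\mid\{\ell\,p\,r\mapsto M\}\uplus H,$$ $$M,N::=V\,W\mid V\,T\mid(\mathsf{return}\,V)^E\mid(\mathsf{do}\,\ell\,V)^E\mid\mathsf{let}^Y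 x\leftarrow M\ \mathsf{in}\ N\mid\mathsf{handle}\,M\,\mathsf{with}\,H,$$ where $\lfloor V\rfloor$ is a *tagged* value. **Kinding** $\Delta\vdash T:K$. Put $\bullet\le\circ$. Subkinding (with subsumption) is $\mathsf{Type}^Y\le\mathsf{Type}^{Y'}$ for $Y\le Y'$, and $\mathsf{Presence}^{Y}\le\mathsf{Presence}^{Y'}$, $\mathsf{Row}^Y_{\mathcal L}\le\mathsf{Row}^{Y'}_{\mathcal L}$ for $Y'\le Y$. For well-formed components, $A\to^YC$ and $\forall^Y\alpha^K.C$ have kind $\mathsf{Type}^Y$, $A\twoheadrightarrow^YB$ has kind $\mathsf{Presence}^Y$, $\mathsf{Abs}$ has kind $\mathsf{Presence}^Y$ and $\cdot$ has kind $\mathsf{Row}_{\mathcal L}^Y$ for all $Y,\mathcal L$; $\ell:P;R$ has kind $\mathsf{Row}^Y_{\mathcal L}$ if $\ell\notin\mathcal L$, $P:\mathsf{Presence}^Y$ and $R:\mathsf{Row}^Y_{\mathcal L\cup\{\ell\}}$; $\{R\}:\mathsf{Effect}$ if $R:\mathsf{Row}_\emptyset^Y$ for some $Y$; $A\,!\,E:\mathsf{Comp}$;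 $C\rightrightarrows D:\mathsf{Handler}$. $\Delta\vdash\Gamma:Y$ means that all types in $\Gamma$ have kind $\mathsf{Type}^Y$. $\Gamma=\Gamma_1+\Gamma_2$ is context splitting: each variable of $\Gamma$ goes to exactly one side, or to both if its type has kind $\mathsf{Type}^\bullet$. **Typing** (all types and contexts well formed; tags are ignored, i.e. $\lfloor V\rfloor:A$ iff $V:A$). - $\Delta;\Gamma,x:A\vdash x:A$ if $\Delta\vdash\Gamma:\bullet$. - $\Delta;\Gamma\vdash\lambda^Yx^A.M:A\to^YC$ if $\Delta\vdash\Gamma:Y$ and $\Delta;\Gamma,x:A\vdash M:C$; $\Delta;\Gamma\vdash\Lambda^Y\alpha^K.M:\forall^Y\alpha^K.C$ if $\Delta\vdash\Gamma:Y$, $\alpha\notin\mathrm{ftv}(\Gamma)$ and $\Delta,\alpha:K;\Gamma\vdash M:C$. - $\Gamma_1+\Gamma_2\vdash V\,W:C$ if $\Gamma_1\vdash V:A\to^YC$ and $\Gamma_2\vdash W:A$; $\Gamma\vdash V\,T:C[T/\alpha]$ if $\Gamma\vdash V:\forall^Y\alpha^K.C$ and $T:K$. - $\Gamma\vdash(\mathsf{return}\,V)^E:A\,!\,E$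 if $\Gamma\vdash V:A$; $\Gamma\vdash(\mathsf{do}\,\ell\,V)^E:B\,!\,E$ if $E=\{\ell:A\twoheadrightarrow^YB;R\}$ and $\Gamma\vdash V:A$. - $\Gamma_1+\Gamma_2\vdash\mathsf{let}^Yx\leftarrow M\ \mathsf{in}\ N:B\,!\,\{R\}$ if $\Gamma_1\vdash M:A\,!\,\{R\}$, $\Gamma_2,x:A\vdash N:B\,!\,\{R\}$, $\Delta\vdash\Gamma_2:Y$ and $\Delta\vdash R:\mathsf{Row}_\emptyset^Y$. - $\Gamma_1+\Gamma_2\vdash\mathsf{handle}\,M\,\mathsf{with}\,H:D$ if $\Gamma_1\vdash H:C\rightrightarrows D$ and $\Gamma_2\vdash M:C$. - $\Gamma\vdash\{\mathsf{return}\,x\mapsto M\}\uplus\{\ell_i\,p_i\,r_i\mapsto N_i\}_i:C\rightrightarrows D$ if $C=A\,!\,\{(\ell_i:A_i\twoheadrightarrow^{Y_i}B_i)_i;R\}$, $D=B\,!\,\{(\ell_i:P)_i;R\}$, $\Delta\vdash\Gamma:\bullet$, $\Gamma,x:A\vdash M:D$, and $\Gamma,p_i:A_i,r_i:B_i\to^{Y_i}D\vdash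 N_i:D$ for all $i$. **Linearity-aware semantics.** Evaluation contexts are $\mathcal E::=[\,]\mid\mathsf{let}^Yx\leftarrow\mathcal E\ \mathsf{in}\ N\mid\mathsf{handle}\,\mathcal E\,\mathsf{with}\,H$; $\mathrm{bl}(\mathcal E)$ is the set of labels handled by the handlers around the hole; tag-removing contexts are $\mathcal F::=[\,]\,W\mid[\,]\,T$. For closed $V$: if $\vdash V:A$ for some $A$ with $\nvdash A:\mathsf{Type}^\bullet$, and $V$ is not of the form $\lfloor W\rfloor$, then $\mathrm{tag}(V)=(\lfloor V\rfloor,\{\lfloor V\rfloor\})$; otherwise $\mathrm{tag}(V)=(V,\emptyset)$. Write $(V',S_V)=\mathrm{tag}(V)$. The relation $M\xrightarrow{S;T}N$ (introducing the multiset $S$ and eliminating the multiset $T$) on closed computations is generated by - $(\lambda^Yx^A.M)\,V\xrightarrow{S_V;\emptyset}M[V'/x]$; $\ (\Lambda^Y\alpha^K.M)\,T\xrightarrow{\emptyset;\emptyset}M[T/\alpha]$; $\ \mathsf{let}^Yx\leftarrow(\mathsf{return}\,V)^E\ \mathsf{in}\ N\xrightarrow{S_V;\emptyset}N[V'/x]$;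 - $\mathsf{handle}\,(\mathsf{return}\,V)^E\,\mathsf{with}\,H\xrightarrow{S_V;\emptyset}N[V'/x]$, where $(\mathsf{return}\,x\mapsto N)\in H$; - $\mathsf{handle}\,\mathcal E[(\mathsf{do}\,\ell\,V)^E]\,\mathsf{with}\,H\xrightarrow{S_V\cup S_W;\emptyset}N[V'/p,W'/r]$, where $\ell\notin\mathrm{bl}(\mathcal E)$, $(\ell\,p\,r\mapsto N)\in H$, $(\ell:A\twoheadrightarrow^YB)\in E$ and $W=\lambda^Yy^B.\mathsf{handle}\,\mathcal E[(\mathsf{return}\,y)^E]\,\mathsf{with}\,H$; - $\mathcal F[\lfloor V\rfloor]\xrightarrow{\emptyset;\{\lfloor V\rfloor\}}\mathcal F[V]$; $\ $ and $\mathcal E[M]\xrightarrow{S;T}\mathcal E[N]$ if $M\xrightarrow{S;T}N$. **Linear safety.** $\mathrm{TL}$ of a term or context is the multiset of all occurrences of tagged values in it ($\mathrm{TL}(\lfloor V\rfloor)=\{\lfloor V\rfloor\}\cup\mathrm{TL}(V)$, homomorphic otherwise; $\cup$ is the additive union of multisets). A well-typed computation $M$ is *linear safe* if 1. $\mathrm{TL}(W)=\emptyset$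 for every value subterm $W$ of the form $\lambda^\bullet x^A.N$ or $\Lambda^\bullet\alpha^K.N$, or with an unlimited type (a type of kind $\mathsf{Type}^\bullet$); 2. $\mathrm{TL}(\mathcal E)=\emptyset$ for every computation subterm $\mathcal E[(\mathsf{do}\,\ell\,V)^E]$ with $(\ell:A\twoheadrightarrow^\bullet B)\in E$ and $\ell\notin\mathrm{bl}(\mathcal E)$; 3. $\mathrm{TL}(H)=\emptyset$ for every handler subterm $H$. Consider also the condition 4. $\mathrm{TL}(N_2)=\emptyset$ for every subterm $\mathsf{let}^\bullet x\leftarrow N_1\ \mathsf{in}\ N_2$. **Theorem (Reduction Safety).** Let $M$ be a closed computation with $\vdash M:C$, in which tags are attached to closed values only, and let $M$ be linear safe. If $M\xrightarrow{S;T}N$, then $$\mathrm{TL}(M)\cup S=\mathrm{TL}(N)\cup T,$$ $\vdash N:C$, tags in $N$ are attached to closed values only, and $N$ satisfies 1 and 3. If moreover $M$ satisfies 4, then $N$ is linear safe and again satisfies 4. (Computations without tags satisfy 1-4, so no tagged linear value is ever duplicated or discarded when such a computation is run, even in the presence of multi-shot deep handlers.) -/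

import Mathlib

/-! The calculus with linear types, row-based effect types and deep effect handlers, in de Bruijn
style: type variables and term variables are two separate families of indices. -/

namespace FEff

/-- Operation labels: a countably infinite set with decidable equality. -/
abbrev Label := ℕ

/-- Linearities: `unl` is `•` (unlimited), `lin` is `∘` (linear). -/
inductive Lin
  | unl
  | lin
  deriving DecidableEq

/-- Kinds.  In `row L Y`, `L` is the set of labels that must not appear in the row. -/
inductive Kind
  | type (Y : Lin)
  | row (L : Finset Label) (Y : Lin)
  | pres (Y : Lin)
  | effect
  | comp
  | handler

/-- The kinds whose syntactic category contains type variables: value types, row types and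
presence types. -/
def Kind.HasVars : Kind → Prop
  | .type _ => True
  | .row _ _ => True
  | .pres _ => True
  | _ => False

/-- All types `T`; the syntactic categories are separated by the kinding rules below. -/
inductive Ty
  /-- type variable (of value, row or presence kind) -/
  | var (n : ℕ)
  /-- `A →^Y C` -/
  | arrow (Y : Lin) (A C : Ty)
  /-- `∀^Y α^K. C`, binding one type variable in `C` -/
  | all (Y : Lin) (K : Kind) (C : Ty)
  /-- `A ! E` -/
  | comp (A E : Ty)
  /-- `{R}` -/
  | eff (R : Ty)
  /-- the empty row -/
  | rowNil
  /-- `ℓ : P; R` -/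
  | rowCons (l : Label) (P R : Ty)
  /-- the presence type `Abs` -/
  | abs
  /-- the operation signature `A ↠^Y B` -/
  | op (Y : Lin) (A B : Ty)
  /-- `C ⇉ D` -/
  | handler (C D : Ty)

/-- Lifting of a renaming of indices under a binder. -/
def upRen (ξ : ℕ → ℕ) : ℕ → ℕ
  | 0 => 0
  | n + 1 => ξ n + 1

namespace Ty

def rename : (ℕ → ℕ) → Ty → Ty
  | ξ, var n => var (ξ n)
  | ξ, arrow Y A C => arrow Y (rename ξ A) (rename ξ C)
  | ξ, all Y K C => all Y K (rename (upRen ξ) C)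
  | ξ, comp A E => comp (rename ξ A) (rename ξ E)
  | ξ, eff R => eff (rename ξ R)
  | _, rowNil => rowNil
  | ξ, rowCons l P R => rowCons l (rename ξ P) (rename ξ R)
  | _, abs => abs
  | ξ, op Y A B => op Y (rename ξ A) (rename ξ B)
  | ξ, handler C D => handler (rename ξ C) (rename ξ D)

/-- Lifting of a type substitution under a type binder. -/
def upSubst (σ : ℕ → Ty) : ℕ → Ty
  | 0 => var 0
  | n + 1 => rename Nat.succ (σ n)

/-- Simultaneous capture-avoiding substitution. -/
def subst : (ℕ → Ty) → Ty → Ty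
  | σ, var n => σ n
  | σ, arrow Y A C => arrow Y (subst σ A) (subst σ C)
  | σ, all Y K C => all Y K (subst (upSubst σ) C)
  | σ, comp A E => comp (subst σ A) (subst σ E)
  | σ, eff R => eff (subst σ R)
  | _, rowNil => rowNil
  | σ, rowCons l P R => rowCons l (subst σ P) (subst σ R)
  | _, abs => abs
  | σ, op Y A B => op Y (subst σ A) (subst σ B)
  | σ, handler C D => handler (subst σ C) (subst σ D)

/-- The substitution replacing variable `0` by `T` and lowering all other variables. -/
def single (T : Ty) : ℕ → Ty
  | 0 => T
  | n + 1 => var n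

/-- `C.inst T` is `C[T/α]`, where `α` is the variable `0` of `C`. -/
def inst (C T : Ty) : Ty := subst (single T) C

/-- Rows that end in the empty row, rather than in a row variable. -/
inductive IsClosedRow : Ty → Prop
  | nil : IsClosedRow rowNil
  | cons {l P R} : IsClosedRow R → IsClosedRow (rowCons l P R)

/-- `RowMem l P R`: the row `R` contains the entry `l : P`. -/
inductive RowMem (l : Label) (P : Ty) : Ty → Prop
  | here {R} : RowMem l P (rowCons l P R)
  | there {l' P' R} : RowMem l P R → RowMem l P (rowCons l' P' R)

/-- `HasOp E l Y A B`: the effect type `E` contains `l : A ↠^Y B`. -/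
def HasOp (E : Ty) (l : Label) (Y : Lin) (A B : Ty) : Prop :=
  ∃ R, E = eff R ∧ RowMem l (op Y A B) R

/-- Identification of types: the least congruence for which the order of the (distinct) labels of
a row is irrelevant and absent labels in closed rows are ignored. -/
inductive Eqv : Ty → Ty → Prop
  | refl (T) : Eqv T T
  | symm {T U} : Eqv T U → Eqv U T
  | trans {T U V} : Eqv T U → Eqv U V → Eqv T V
  | arrow {Y A A' C C'} : Eqv A A' → Eqv C C' → Eqv (arrow Y A C) (arrow Y A' C')
  | all {Y K C C'} : Eqv C C' → Eqv (all Y K C) (all Y K C')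
  | comp {A A' E E'} : Eqv A A' → Eqv E E' → Eqv (comp A E) (comp A' E')
  | eff {R R'} : Eqv R R' → Eqv (eff R) (eff R')
  | rowCons {l P P' R R'} : Eqv P P' → Eqv R R' → Eqv (rowCons l P R) (rowCons l P' R')
  | op {Y A A' B B'} : Eqv A A' → Eqv B B' → Eqv (op Y A B) (op Y A' B')
  | handler {C C' D D'} : Eqv C C' → Eqv D D' → Eqv (handler C D) (handler C' D')
  | swap {l l' P P' R} : l ≠ l' →
      Eqv (rowCons l P (rowCons l' P' R)) (rowCons l' P' (rowCons l P R))
  | absent {l R} : IsClosedRow R → Eqv (rowCons l abs R) R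

/-- The row `(ℓᵢ : Aᵢ ↠^{Yᵢ} Bᵢ)ᵢ; R`. -/
def opsRow : List (Label × Lin × Ty × Ty) → Ty → Ty
  | [], R => R
  | (l, Y, A, B) :: sigs, R => rowCons l (op Y A B) (opsRow sigs R)

/-- The row `(ℓᵢ : P)ᵢ; R`, with the labels of the given signatures. -/
def presRow : List (Label × Lin × Ty × Ty) → Ty → Ty → Ty
  | [], _, R => R
  | (l, _, _, _) :: sigs, P, R => rowCons l P (presRow sigs P R)

end Ty

/-- `Y ≤ Y'`, generated by `• ≤ ∘`. -/
inductive Lin.Le : Lin → Lin → Prop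
  | refl (Y) : Lin.Le Y Y
  | unl_lin : Lin.Le .unl .lin

/-- Subkinding: covariant for value types, contravariant for presence and row types. -/
inductive Kind.Sub : Kind → Kind → Prop
  | type {Y Y'} : Lin.Le Y Y' → Kind.Sub (.type Y) (.type Y')
  | pres {Y Y'} : Lin.Le Y' Y → Kind.Sub (.pres Y) (.pres Y')
  | row {L Y Y'} : Lin.Le Y' Y → Kind.Sub (.row L Y) (.row L Y')

/-- Kind contexts: the kind of type variable `n` is the `n`-th entry. -/
abbrev KCtx := List Kind

/-- The kinding judgement `Δ ⊢ T : K`. -/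
inductive Kinding : KCtx → Ty → Kind → Prop
  | var {Δ n K} : Δ[n]? = some K → K.HasVars → Kinding Δ (.var n) K
  | all {Δ Y K C} : Kinding (K :: Δ) C .comp → Kinding Δ (.all Y K C) (.type Y)
  | arrow {Δ Y Y' A C} : Kinding Δ A (.type Y') → Kinding Δ C .comp →
      Kinding Δ (.arrow Y A C) (.type Y)
  | comp {Δ Y A E} : Kinding Δ A (.type Y) → Kinding Δ E .effect → Kinding Δ (.comp A E) .comp
  | eff {Δ R Y} : Kinding Δ R (.row ∅ Y) → Kinding Δ (.eff R) .effect
  | op {Δ Y Y₁ Y₂ A B} : Kinding Δ A (.type Y₁) → Kinding Δ B (.type Y₂) →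
      Kinding Δ (.op Y A B) (.pres Y)
  | abs {Δ Y} : Kinding Δ .abs (.pres Y)
  | rowNil {Δ L Y} : Kinding Δ .rowNil (.row L Y)
  | rowCons {Δ l P R L Y} : Kinding Δ P (.pres Y) → l ∉ L → Kinding Δ R (.row (insert l L) Y) →
      Kinding Δ (.rowCons l P R) (.row L Y)
  | handler {Δ C D} : Kinding Δ C .comp → Kinding Δ D .comp → Kinding Δ (.handler C D) .handler
  | upcast {Δ T K K'} : Kinding Δ T K → Kind.Sub K K' → Kinding Δ T K'

/-! ### Terms -/

mutual
/-- Values, including values carrying a linear tag. -/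
inductive Val
  | var (n : ℕ)
  /-- `λ^Y x^A. M` -/
  | lam (Y : Lin) (A : Ty) (M : Comp)
  /-- `Λ^Y α^K. M` -/
  | tlam (Y : Lin) (K : Kind) (M : Comp)
  /-- the tagged value `⌊V⌋` -/
  | tag (V : Val)
/-- Computations. -/
inductive Comp
  | app (V W : Val)
  | tapp (V : Val) (T : Ty)
  /-- `(return V)^E` -/
  | ret (V : Val) (E : Ty)
  /-- `(do l V)^E` -/
  | perform (l : Label) (V : Val) (E : Ty)
  /-- `let^Y x ← M in N`, binding `x` in `N` -/
  | bind (Y : Lin) (M N : Comp)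
  /-- `handle M with H` -/
  | handle (M : Comp) (H : Hnd)
/-- Handlers. -/
inductive Hnd
  /-- `{return x ↦ M}`, binding `x` in `M` -/
  | ret (M : Comp)
  /-- `{l p r ↦ M} ⊎ H`, binding `p` (index `1`) and `r` (index `0`) in `M` -/
  | op (l : Label) (M : Comp) (H : Hnd)
end

mutual
/-- Renaming of type variables (by `ζ`) and term variables (by `ξ`). -/
def Val.rename : (ℕ → ℕ) → (ℕ → ℕ) → Val → Val
  | _, ξ, .var n => .var (ξ n)
  | ζ, ξ, .lam Y A M => .lam Y (A.rename ζ) (M.rename ζ (upRen ξ))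
  | ζ, ξ, .tlam Y K M => .tlam Y K (M.rename (upRen ζ) ξ)
  | ζ, ξ, .tag V => .tag (V.rename ζ ξ)
def Comp.rename : (ℕ → ℕ) → (ℕ → ℕ) → Comp → Comp
  | ζ, ξ, .app V W => .app (V.rename ζ ξ) (W.rename ζ ξ)
  | ζ, ξ, .tapp V T => .tapp (V.rename ζ ξ) (T.rename ζ)
  | ζ, ξ, .ret V E => .ret (V.rename ζ ξ) (E.rename ζ)
  | ζ, ξ, .perform l V E => .perform l (V.rename ζ ξ) (E.rename ζ)
  | ζ, ξ, .bind Y M N => .bind Y (M.rename ζ ξ) (N.rename ζ (upRen ξ))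
  | ζ, ξ, .handle M H => .handle (M.rename ζ ξ) (H.rename ζ ξ)
def Hnd.rename : (ℕ → ℕ) → (ℕ → ℕ) → Hnd → Hnd
  | ζ, ξ, .ret M => .ret (M.rename ζ (upRen ξ))
  | ζ, ξ, .op l M H => .op l (M.rename ζ (upRen (upRen ξ))) (H.rename ζ ξ)
end

/-- Lifting of a value substitution under a term binder. -/
def upVal (σ : ℕ → Val) : ℕ → Val
  | 0 => .var 0
  | n + 1 => (σ n).rename id Nat.succ

/-- Lifting of a value substitution under a type binder. -/
def tupVal (σ : ℕ → Val) : ℕ → Val := fun n => (σ n).rename Nat.succ id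

mutual
/-- Simultaneous capture-avoiding substitution for type variables (by `τ`) and term variables
(by `σ`). -/
def Val.subst : (ℕ → Ty) → (ℕ → Val) → Val → Val
  | _, σ, .var n => σ n
  | τ, σ, .lam Y A M => .lam Y (A.subst τ) (M.subst τ (upVal σ))
  | τ, σ, .tlam Y K M => .tlam Y K (M.subst (Ty.upSubst τ) (tupVal σ))
  | τ, σ, .tag V => .tag (V.subst τ σ)
def Comp.subst : (ℕ → Ty) → (ℕ → Val) → Comp → Comp
  | τ, σ, .app V W => .app (V.subst τ σ) (W.subst τ σ)
  | τ, σ, .tapp V T => .tapp (V.subst τ σ) (T.subst τ)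
  | τ, σ, .ret V E => .ret (V.subst τ σ) (E.subst τ)
  | τ, σ, .perform l V E => .perform l (V.subst τ σ) (E.subst τ)
  | τ, σ, .bind Y M N => .bind Y (M.subst τ σ) (N.subst τ (upVal σ))
  | τ, σ, .handle M H => .handle (M.subst τ σ) (H.subst τ σ)
def Hnd.subst : (ℕ → Ty) → (ℕ → Val) → Hnd → Hnd
  | τ, σ, .ret M => .ret (M.subst τ (upVal σ))
  | τ, σ, .op l M H => .op l (M.subst τ (upVal (upVal σ))) (H.subst τ σ)
end

/-- The substitution `[V/0]`. -/
def single (V : Val) : ℕ → Val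
  | 0 => V
  | n + 1 => .var n

/-- The substitution `[W/0, V/1]`. -/
def double (V W : Val) : ℕ → Val
  | 0 => W
  | 1 => V
  | n + 2 => .var n

/-- `M[V/x]`, where `x` is the term variable `0`. -/
def Comp.inst (M : Comp) (V : Val) : Comp := M.subst Ty.var (single V)

/-- `M[V/p, W/r]`, where `p` is the term variable `1` and `r` the term variable `0`. -/
def Comp.inst₂ (M : Comp) (V W : Val) : Comp := M.subst Ty.var (double V W)

/-- `M[T/α]`, where `α` is the type variable `0`. -/
def Comp.tinst (M : Comp) (T : Ty) : Comp := M.subst (Ty.single T) Val.var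

/-! ### Typing -/

/-- Type contexts.  The `n`-th entry is `some A` if term variable `n` is in the context with type
`A`, and `none` if that variable has been given away by context splitting. -/
abbrev Ctx := List (Option Ty)

/-- Weakening of a type context by one type variable. -/
def Ctx.tshift (Γ : Ctx) : Ctx := Γ.map (Option.map (Ty.rename Nat.succ))

/-- `Δ ⊢ Γ : Y`. -/
def CtxLin (Δ : KCtx) (Γ : Ctx) (Y : Lin) : Prop :=
  ∀ A, some A ∈ Γ → Kinding Δ A (.type Y)

/-- Context splitting `Δ ⊢ Γ = Γ₁ + Γ₂`. -/
inductive Split (Δ : KCtx) : Ctx → Ctx → Ctx → Prop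
  | nil : Split Δ [] [] []
  | none {Γ Γ₁ Γ₂} : Split Δ Γ Γ₁ Γ₂ → Split Δ (none :: Γ) (none :: Γ₁) (none :: Γ₂)
  | unl {Γ Γ₁ Γ₂ A} : Kinding Δ A (.type .unl) → Split Δ Γ Γ₁ Γ₂ →
      Split Δ (some A :: Γ) (some A :: Γ₁) (some A :: Γ₂)
  | linLeft {Γ Γ₁ Γ₂ A} : Kinding Δ A (.type .lin) → Split Δ Γ Γ₁ Γ₂ →
      Split Δ (some A :: Γ) (some A :: Γ₁) (.none :: Γ₂)
  | linRight {Γ Γ₁ Γ₂ A} : Kinding Δ A (.type .lin) → Split Δ Γ Γ₁ Γ₂ →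
      Split Δ (some A :: Γ) (.none :: Γ₁) (some A :: Γ₂)

mutual
/-- `Δ; Γ ⊢ V : A`.  Tags are ignored. -/
inductive ValTy : KCtx → Ctx → Val → Ty → Prop
  | var {Δ Γ n A} : Γ[n]? = some (some A) → Kinding Δ A (.type .lin) →
      (∀ m B, m ≠ n → Γ[m]? = some (some B) → Kinding Δ B (.type .unl)) →
      ValTy Δ Γ (.var n) A
  | lam {Δ Γ Y Y' A M C} : CtxLin Δ Γ Y → Kinding Δ A (.type Y') →
      CompTy Δ (some A :: Γ) M C → ValTy Δ Γ (.lam Y A M) (.arrow Y A C)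
  | tlam {Δ Γ Y K M C} : CtxLin Δ Γ Y → CompTy (K :: Δ) (Ctx.tshift Γ) M C →
      ValTy Δ Γ (.tlam Y K M) (.all Y K C)
  | tag {Δ Γ V A} : ValTy Δ Γ V A → ValTy Δ Γ (.tag V) A
  /-- types are identified up to `Ty.Eqv` -/
  | conv {Δ Γ V A B Y} : ValTy Δ Γ V A → Ty.Eqv A B → Kinding Δ B (.type Y) → ValTy Δ Γ V B
/-- `Δ; Γ ⊢ M : C`. -/
inductive CompTy : KCtx → Ctx → Comp → Ty → Prop
  | app {Δ Γ Γ₁ Γ₂ V W Y A C} : Split Δ Γ Γ₁ Γ₂ → ValTy Δ Γ₁ V (.arrow Y A C) →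
      ValTy Δ Γ₂ W A → CompTy Δ Γ (.app V W) C
  | tapp {Δ Γ V Y K C T} : ValTy Δ Γ V (.all Y K C) → Kinding Δ T K →
      CompTy Δ Γ (.tapp V T) (C.inst T)
  | ret {Δ Γ V A E} : ValTy Δ Γ V A → Kinding Δ E .effect → CompTy Δ Γ (.ret V E) (.comp A E)
  | perform {Δ Γ l V Y A B R E} : Ty.Eqv E (.eff (.rowCons l (.op Y A B) R)) →
      Kinding Δ (.eff (.rowCons l (.op Y A B) R)) .effect → Kinding Δ E .effect →
      ValTy Δ Γ V A → CompTy Δ Γ (.perform l V E) (.comp B E)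
  | bind {Δ Γ Γ₁ Γ₂ Y M N A B R} : Split Δ Γ Γ₁ Γ₂ → CompTy Δ Γ₁ M (.comp A (.eff R)) →
      CompTy Δ (some A :: Γ₂) N (.comp B (.eff R)) → CtxLin Δ Γ₂ Y → Kinding Δ R (.row ∅ Y) →
      CompTy Δ Γ (.bind Y M N) (.comp B (.eff R))
  | handle {Δ Γ Γ₁ Γ₂ M H C D} : Split Δ Γ Γ₁ Γ₂ → HndTy Δ Γ₁ H C D → CompTy Δ Γ₂ M C →
      CompTy Δ Γ (.handle M H) D
  /-- types are identified up to `Ty.Eqv` -/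
  | conv {Δ Γ M C D} : CompTy Δ Γ M C → Ty.Eqv C D → Kinding Δ D .comp → CompTy Δ Γ M D
/-- `Δ; Γ ⊢ H : C ⇉ D`, where `C = A ! {(ℓᵢ : Aᵢ ↠^{Yᵢ} Bᵢ)ᵢ; R}` and `D = B ! {(ℓᵢ : P)ᵢ; R}`. -/
inductive HndTy : KCtx → Ctx → Hnd → Ty → Ty → Prop
  | handler {Δ Γ H A B sigs P R} : CtxLin Δ Γ .unl →
      Kinding Δ (.comp A (.eff (Ty.opsRow sigs R))) .comp →
      Kinding Δ (.comp B (.eff (Ty.presRow sigs P R))) .comp →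
      ClausesTy Δ Γ H A sigs (.comp B (.eff (Ty.presRow sigs P R))) →
      HndTy Δ Γ H (.comp A (.eff (Ty.opsRow sigs R))) (.comp B (.eff (Ty.presRow sigs P R)))
/-- The clauses of `H` have type `D`, where the return clause takes an argument of type `A` and the
operation clauses handle exactly the operations with the listed signatures `(ℓᵢ, Yᵢ, Aᵢ, Bᵢ)`. -/
inductive ClausesTy : KCtx → Ctx → Hnd → Ty → List (Label × Lin × Ty × Ty) → Ty → Prop
  | ret {Δ Γ M A D} : CompTy Δ (some A :: Γ) M D → ClausesTy Δ Γ (.ret M) A [] D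
  | op {Δ Γ l N H A Y A' B' sigs D} :
      CompTy Δ (some (.arrow Y B' D) :: some A' :: Γ) N D → ClausesTy Δ Γ H A sigs D →
      ClausesTy Δ Γ (.op l N H) A ((l, Y, A', B') :: sigs) D
end

/-! ### Linearity-aware small-step semantics -/

/-- `H.retBody` is the `N` with `(return x ↦ N) ∈ H`. -/
def Hnd.retBody : Hnd → Comp
  | .ret M => M
  | .op _ _ H => H.retBody

/-- `H.HasClause l N`: `(l p r ↦ N) ∈ H`. -/
def Hnd.HasClause : Hnd → Label → Comp → Prop
  | .ret _, _, _ => False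
  | .op l M H, l', N => (l = l' ∧ M = N) ∨ H.HasClause l' N

/-- The set of operation labels that `H` handles. -/
def Hnd.dom : Hnd → Finset Label
  | .ret _ => ∅
  | .op l _ H => insert l H.dom

/-- Evaluation contexts. -/
inductive ECtx
  | hole
  | bind (Y : Lin) (E : ECtx) (N : Comp)
  | handle (E : ECtx) (H : Hnd)

/-- `𝓔[M]`. -/
def ECtx.plug : ECtx → Comp → Comp
  | .hole, M => M
  | .bind Y E N, M => .bind Y (E.plug M) N
  | .handle E H, M => .handle (E.plug M) H

/-- The weakening of an evaluation context by one term variable. -/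
def ECtx.shift : ECtx → ECtx
  | .hole => .hole
  | .bind Y E N => .bind Y E.shift (N.rename id (upRen Nat.succ))
  | .handle E H => .handle E.shift (H.rename id Nat.succ)

/-- The bound labels of an evaluation context. -/
def ECtx.bl : ECtx → Finset Label
  | .hole => ∅
  | .bind _ E _ => E.bl
  | .handle E H => E.bl ∪ H.dom

/-- Tag-removing contexts `[ ] W` and `[ ] T`. -/
inductive FCtx
  | app (W : Val)
  | tapp (T : Ty)

def FCtx.plug : FCtx → Val → Comp
  | .app W, V => .app V W
  | .tapp T, V => .tapp V T

/-- `lin(V)`, for closed `V`. -/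
def Val.IsLin (V : Val) : Prop := ∃ A, ValTy [] [] V A ∧ ¬ Kinding [] A (.type .unl)

open Classical in
/-- `tag(V)`, for closed `V`. -/
noncomputable def Val.mark (V : Val) : Val × Multiset Val :=
  if V.IsLin ∧ ∀ W, V ≠ .tag W then (.tag V, {.tag V}) else (V, 0)

/-- `Step M S T N`: the closed computation `M` steps to `N`, introducing the multiset `S` of tagged
linear values and eliminating the multiset `T`. -/
inductive Step : Comp → Multiset Val → Multiset Val → Comp → Prop
  | app {Y A M V} : Step (.app (.lam Y A M) V) V.mark.2 0 (M.inst V.mark.1)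
  | tapp {Y K M T} : Step (.tapp (.tlam Y K M) T) 0 0 (M.tinst T)
  | seq {Y V E N} : Step (.bind Y (.ret V E) N) V.mark.2 0 (N.inst V.mark.1)
  | ret {V E H} : Step (.handle (.ret V E) H) V.mark.2 0 (H.retBody.inst V.mark.1)
  | op {𝓔 : ECtx} {l V E H N Y A B W} : l ∉ 𝓔.bl → H.HasClause l N → E.HasOp l Y A B →
      W = Val.lam Y B (.handle (𝓔.shift.plug (.ret (.var 0) E)) (H.rename id Nat.succ)) →
      Step (.handle (𝓔.plug (.perform l V E)) H) (V.mark.2 + W.mark.2) 0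
        (N.inst₂ V.mark.1 W.mark.1)
  | remove {F : FCtx} {V} : Step (F.plug (.tag V)) 0 {.tag V} (F.plug V)
  | lift {𝓔 : ECtx} {M S T N} : Step M S T N → Step (𝓔.plug M) S T (𝓔.plug N)

/-! ### Tagged linear values and linear safety -/

mutual
/-- The multiset of tagged values occurring in a value. -/
def Val.tl : Val → Multiset Val
  | .var _ => 0
  | .lam _ _ M => M.tl
  | .tlam _ _ M => M.tl
  | .tag V => {.tag V} + V.tl
def Comp.tl : Comp → Multiset Val
  | .app V W => V.tl + W.tl
  | .tapp V _ => V.tl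
  | .ret V _ => V.tl
  | .perform _ V _ => V.tl
  | .bind _ M N => M.tl + N.tl
  | .handle M H => M.tl + H.tl
def Hnd.tl : Hnd → Multiset Val
  | .ret M => M.tl
  | .op _ M H => M.tl + H.tl
end

def ECtx.tl : ECtx → Multiset Val
  | .hole => 0
  | .bind _ E N => E.tl + N.tl
  | .handle E H => E.tl + H.tl

/-- Values, computations and handlers taken together. -/
inductive Term
  | val (V : Val)
  | comp (M : Comp)
  | hnd (H : Hnd)

/-- `Child s t`: `s` is an immediate subterm of `t`. -/
inductive Term.Child : Term → Term → Prop
  | lam {Y A M} : Child (.comp M) (.val (.lam Y A M))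
  | tlam {Y K M} : Child (.comp M) (.val (.tlam Y K M))
  | tag {V} : Child (.val V) (.val (.tag V))
  | app_left {V W} : Child (.val V) (.comp (.app V W))
  | app_right {V W} : Child (.val W) (.comp (.app V W))
  | tapp {V T} : Child (.val V) (.comp (.tapp V T))
  | ret {V E} : Child (.val V) (.comp (.ret V E))
  | perform {l V E} : Child (.val V) (.comp (.perform l V E))
  | bind_left {Y M N} : Child (.comp M) (.comp (.bind Y M N))
  | bind_right {Y M N} : Child (.comp N) (.comp (.bind Y M N))
  | handle_left {M H} : Child (.comp M) (.comp (.handle M H))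
  | handle_right {M H} : Child (.hnd H) (.comp (.handle M H))
  | hret {M} : Child (.comp M) (.hnd (.ret M))
  | hop {l M H} : Child (.comp M) (.hnd (.op l M H))
  | hrest {l M H} : Child (.hnd H) (.hnd (.op l M H))

/-- `Sub s t`: `s` is a (not necessarily proper) subterm of `t`. -/
def Term.Sub : Term → Term → Prop := Relation.ReflTransGen Term.Child

/-- A value that is claimed to be unlimited: it has the form `λ^• x^A. N` or `Λ^• α^K. N`, or it
has an unlimited type. -/
def Val.IsUnl (W : Val) : Prop :=
  (∃ A N, W = .lam .unl A N) ∨ (∃ K N, W = .tlam .unl K N) ∨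
    ∃ Δ Γ A, ValTy Δ Γ W A ∧ Kinding Δ A (.type .unl)

/-- No tagged value occurs in an unlimited value. -/
def Comp.UnlimitedValuesSafe (M : Comp) : Prop :=
  ∀ W : Val, Term.Sub (.val W) (.comp M) → W.IsUnl → W.tl = 0

/-- No tagged value occurs in an evaluation context around an unhandled operation that is
control-flow unlimited. -/
def Comp.UnlimitedContextsSafe (M : Comp) : Prop :=
  ∀ (𝓔 : ECtx) (l : Label) (V : Val) (E A B : Ty),
    Term.Sub (.comp (𝓔.plug (.perform l V E))) (.comp M) → E.HasOp l .unl A B → l ∉ 𝓔.bl →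
      𝓔.tl = 0

/-- No tagged value occurs in a handler. -/
def Comp.HandlersSafe (M : Comp) : Prop :=
  ∀ H : Hnd, Term.Sub (.hnd H) (.comp M) → H.tl = 0

/-- Linear safety of a (well-typed) computation. -/
structure Comp.LinearSafe (M : Comp) : Prop where
  values : M.UnlimitedValuesSafe
  contexts : M.UnlimitedContextsSafe
  handlers : M.HandlersSafe

/-- No tagged value occurs in the continuation `N₂` of a sequencing `let^• x ← N₁ in N₂` that is
annotated as control-flow unlimited. -/
def Comp.UnlimitedLetsSafe (M : Comp) : Prop :=
  ∀ N₁ N₂ : Comp, Term.Sub (.comp (.bind .unl N₁ N₂)) (.comp M) → N₂.tl = 0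

/-- Tags are attached to closed (well-typed) values only. -/
def Comp.TagsClosed (M : Comp) : Prop :=
  ∀ V : Val, Term.Sub (.val (.tag V)) (.comp M) → ∃ A, ValTy [] [] V A

end FEff

-- The core is an accounting principle for substitution. If `M` is typed in `Γ` and `σ` replaces the
-- variables of `Γ` by closed values, then the tagged values of `M[σ]` are those of `M` plus those
-- of `σ`, with each variable of `Γ` counted once (`CompTy.closedSubst`). Context splitting sends a
-- linear variable to exactly one place. An unlimited variable may be copied or dropped, but it
-- stands for a value of unlimited type, which carries no tags. For the same reason nothing tagged
-- enters an unlimited abstraction, a handler or the continuation of a `let^•`: their surrounding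
-- contexts are unlimited. Tags sit on closed values, so substitution leaves tagged values literally
-- unchanged and the multisets of terms can be compared.
--
-- The invariant is the structural predicate `Comp.Good c`: conditions 1 and 3 and closedness of
-- tags, together with condition 4 when the proposition `c` holds. Condition 1 quantifies over all
-- typings of a value, but the kind of an arrow or universal type depends only on its annotation,
-- and identification of types preserves annotations. Hence, tagged values aside, unlimitedness can
-- be read off the term (`ValTy.lam_unl`, `ValTy.tlam_unl`).
--
-- `Step.preservation` proves the multiset equation, the typing and `Good c` together, for every
-- `c`. Only the operation rule needs condition 2: the captured continuation `λ^Y y. handle 𝓔[return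
-- y] with H` carries the tags of `𝓔`, so these must be absent when `Y = •`. That `Y` is also the
-- linearity expected by the handler clause follows because an unhandled operation persists in the
-- effect row through all frames of `𝓔` (`ECtx.hasOp`) and labels in a row are distinct
-- (`RowMem.unique`).
--
-- Condition 2 is not inductive by itself, since a reduction may expose an operation in a context
-- where none stood before. With condition 4 it follows from typing: a row containing `A ↠^• B` only
-- has kind `Row^•`, so each `let` between the operation and its handler is annotated `•` and has a
-- tag-free continuation; the handlers in between are tag-free by condition 3
-- (`ECtx.tl_eq_zero_of_good`).

namespace FEff

/-! ### Linearities and kinding -/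

theorem Lin.Le.trans {X Y Z : Lin} (h : Lin.Le X Y) (h' : Lin.Le Y Z) : Lin.Le X Z := by
  cases h <;> cases h' <;> constructor

theorem Lin.Le.eq_unl {Y : Lin} (h : Lin.Le Y .unl) : Y = .unl := by
  cases h; rfl

theorem Lin.unl_le (Y : Lin) : Lin.Le .unl Y := by
  cases Y <;> constructor

theorem Lin.le_lin (Y : Lin) : Lin.Le Y .lin := by
  cases Y <;> constructor

namespace Kinding

theorem to_lin {Δ : KCtx} {A : Ty} {Y : Lin} (h : Kinding Δ A (.type Y)) :
    Kinding Δ A (.type .lin) := .upcast h (.type (Lin.le_lin Y))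

theorem of_unl {Δ : KCtx} {A : Ty} (h : Kinding Δ A (.type .unl)) (Y : Lin) :
    Kinding Δ A (.type Y) := .upcast h (.type (Lin.unl_le Y))

theorem arrow_inv {Δ : KCtx} {Y : Lin} {A C : Ty} {K : Kind} (h : Kinding Δ (.arrow Y A C) K) :
    (∃ Y', K = .type Y' ∧ Lin.Le Y Y') ∧ Kinding Δ A (.type .lin) ∧ Kinding Δ C .comp := by
  generalize hT : Ty.arrow Y A C = T at h
  induction h with
  | arrow hA hC => cases hT; exact ⟨⟨_, rfl, .refl _⟩, hA.to_lin, hC⟩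
  | upcast _ hs ih =>
    obtain ⟨⟨Y', rfl, hY⟩, h⟩ := ih hT
    cases hs with | type hs => exact ⟨⟨_, rfl, hY.trans hs⟩, h⟩
  | _ => cases hT

theorem all_inv {Δ : KCtx} {Y : Lin} {K' : Kind} {C : Ty} {K : Kind}
    (h : Kinding Δ (.all Y K' C) K) :
    (∃ Y', K = .type Y' ∧ Lin.Le Y Y') ∧ Kinding (K' :: Δ) C .comp := by
  generalize hT : Ty.all Y K' C = T at h
  induction h with
  | all hC => cases hT; exact ⟨⟨_, rfl, .refl _⟩, hC⟩
  | upcast _ hs ih =>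
    obtain ⟨⟨Y', rfl, hY⟩, h⟩ := ih hT
    cases hs with | type hs => exact ⟨⟨_, rfl, hY.trans hs⟩, h⟩
  | _ => cases hT

theorem comp_inv {Δ : KCtx} {A E : Ty} {K : Kind} (h : Kinding Δ (.comp A E) K) :
    K = .comp ∧ Kinding Δ A (.type .lin) ∧ Kinding Δ E .effect := by
  generalize hT : Ty.comp A E = T at h
  induction h with
  | comp hA hE => cases hT; exact ⟨rfl, hA.to_lin, hE⟩
  | upcast _ hs ih => obtain ⟨rfl, h⟩ := ih hT; cases hs
  | _ => cases hT

theorem eff_inv {Δ : KCtx} {R : Ty} {K : Kind} (h : Kinding Δ (.eff R) K) :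
    K = .effect ∧ ∃ Y, Kinding Δ R (.row ∅ Y) := by
  generalize hT : Ty.eff R = T at h
  induction h with
  | eff hR => cases hT; exact ⟨rfl, _, hR⟩
  | upcast _ hs ih => obtain ⟨rfl, h⟩ := ih hT; cases hs
  | _ => cases hT

/-- Contravariance of subkinding gives `Y' ≤ Y`: a control-flow unlimited signature has only the
unlimited presence kind. This forces the annotations of surrounding `let`s in
`ECtx.tl_eq_zero_of_good`. -/
theorem op_inv {Δ : KCtx} {Y : Lin} {A B : Ty} {K : Kind} (h : Kinding Δ (.op Y A B) K) :
    (∃ Y', K = .pres Y' ∧ Lin.Le Y' Y) ∧ Kinding Δ A (.type .lin) ∧ Kinding Δ B (.type .lin) := by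
  generalize hT : Ty.op Y A B = T at h
  induction h with
  | op hA hB => cases hT; exact ⟨⟨_, rfl, .refl _⟩, hA.to_lin, hB.to_lin⟩
  | upcast _ hs ih =>
    obtain ⟨⟨Y', rfl, hY⟩, h⟩ := ih hT
    cases hs with | pres hs => exact ⟨⟨_, rfl, hs.trans hY⟩, h⟩
  | _ => cases hT

theorem rowCons_inv {Δ : KCtx} {l : Label} {P R : Ty} {K : Kind}
    (h : Kinding Δ (.rowCons l P R) K) :
    ∃ L Y, K = .row L Y ∧ l ∉ L ∧ Kinding Δ P (.pres Y) ∧ Kinding Δ R (.row (insert l L) Y) := by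
  generalize hT : Ty.rowCons l P R = T at h
  induction h with
  | rowCons hP hl hR => cases hT; exact ⟨_, _, rfl, hl, hP, hR⟩
  | upcast _ hs ih =>
    obtain ⟨L, Y, rfl, hl, hP, hR⟩ := ih hT
    cases hs with
    | row hs => exact ⟨_, _, rfl, hl, .upcast hP (.pres hs), .upcast hR (.row hs)⟩
  | _ => cases hT

end Kinding

/-! ### Rows -/

namespace Ty

/-- The set `L` grows by each label passed on the way into the row, and every later entry has to
avoid it. -/
theorem RowMem.not_mem {Δ : KCtx} {l : Label} {P R : Ty} (hm : RowMem l P R) {L : Finset Label}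
    {Y : Lin} (h : Kinding Δ R (.row L Y)) : l ∉ L := by
  induction hm generalizing L with
  | here =>
    obtain ⟨_, _, hK, hl, -⟩ := h.rowCons_inv
    cases hK; exact hl
  | there _ ih =>
    obtain ⟨_, _, hK, -, -, hR⟩ := h.rowCons_inv
    cases hK; exact fun hl => ih hR (Finset.mem_insert_of_mem hl)

theorem RowMem.kinding {Δ : KCtx} {l : Label} {P R : Ty} (hm : RowMem l P R) {L : Finset Label}
    {Y : Lin} (h : Kinding Δ R (.row L Y)) : Kinding Δ P (.pres Y) := by
  induction hm generalizing L with
  | here =>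
    obtain ⟨_, _, hK, -, hP, -⟩ := h.rowCons_inv
    cases hK; exact hP
  | there _ ih =>
    obtain ⟨_, _, hK, -, -, hR⟩ := h.rowCons_inv
    cases hK; exact ih hR

/-- Behind an entry for `l` the tail has a kind that forbids `l`. This makes the signature of an
operation in a well-kinded row well defined. -/
theorem RowMem.unique {Δ : KCtx} {l : Label} {P P' R : Ty} (hm : RowMem l P R)
    (hm' : RowMem l P' R) {L : Finset Label} {Y : Lin} (h : Kinding Δ R (.row L Y)) : P = P' := by
  induction hm generalizing L with
  | here =>
    obtain ⟨_, _, hK, -, -, hR⟩ := h.rowCons_inv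
    cases hK
    cases hm' with
    | here => rfl
    | there hm' => exact absurd (Finset.mem_insert_self _ _) (hm'.not_mem hR)
  | there hm ih =>
    obtain ⟨_, _, hK, -, -, hR⟩ := h.rowCons_inv
    cases hK
    cases hm' with
    | here => exact absurd (Finset.mem_insert_self _ _) (hm.not_mem hR)
    | there hm' => exact ih hm' hR

theorem rowMem_opsRow {l : Label} {Y : Lin} {A B R : Ty} {sigs : List (Label × Lin × Ty × Ty)}
    (h : (l, Y, A, B) ∈ sigs) : RowMem l (op Y A B) (opsRow sigs R) := by
  induction sigs with
  | nil => cases h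
  | cons s sigs ih =>
    rcases List.mem_cons.1 h with rfl | h
    · exact .here
    · exact .there (ih h)

/-- An entry with an unhandled label lies in the tail `R`, which the input and output rows of a
handler share. -/
theorem RowMem.presRow_of_opsRow {l : Label} {P Q R : Ty}
    {sigs : List (Label × Lin × Ty × Ty)} (h : RowMem l P (opsRow sigs R))
    (hl : l ∉ sigs.map Prod.fst) : RowMem l P (presRow sigs Q R) := by
  induction sigs with
  | nil => exact h
  | cons s sigs ih =>
    rw [List.map_cons, List.mem_cons, not_or] at hl
    cases h with
    | here => exact absurd rfl hl.1
    | there h => exact .there (ih h hl.2)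

/-! ### Identification of types -/

namespace Eqv

/-- Stated in both directions so that the induction passes through `symm`. The rule `absent` cannot
interfere, because an arrow is not a closed row. The lemmas for the other type formers follow the
same pattern. -/
theorem arrow_iff_aux {T U : Ty} (h : Eqv T U) :
    (∀ Y A C, T = .arrow Y A C → ∃ A' C', U = .arrow Y A' C' ∧ Eqv A A' ∧ Eqv C C') ∧
    (∀ Y A C, U = .arrow Y A C → ∃ A' C', T = .arrow Y A' C' ∧ Eqv A A' ∧ Eqv C C') := by
  induction h with
  | refl T => exact ⟨fun _ _ _ h => ⟨_, _, h, .refl _, .refl _⟩,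
      fun _ _ _ h => ⟨_, _, h, .refl _, .refl _⟩⟩
  | symm _ ih => exact ih.symm
  | trans _ _ ih₁ ih₂ =>
    constructor
    · intro Y A C h
      obtain ⟨_, _, h, hA, hC⟩ := ih₁.1 _ _ _ h
      obtain ⟨_, _, h, hA', hC'⟩ := ih₂.1 _ _ _ h
      exact ⟨_, _, h, hA.trans hA', hC.trans hC'⟩
    · intro Y A C h
      obtain ⟨_, _, h, hA, hC⟩ := ih₂.2 _ _ _ h
      obtain ⟨_, _, h, hA', hC'⟩ := ih₁.2 _ _ _ h
      exact ⟨_, _, h, hA.trans hA', hC.trans hC'⟩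
  | arrow hA hC =>
    constructor <;> rintro Y A C ⟨⟩
    · exact ⟨_, _, rfl, hA, hC⟩
    · exact ⟨_, _, rfl, hA.symm, hC.symm⟩
  | absent hR => constructor <;> rintro Y A C ⟨⟩; cases hR
  | _ => constructor <;> rintro Y A C ⟨⟩

theorem arrow_inv {Y : Lin} {A C U : Ty} (h : Eqv (.arrow Y A C) U) :
    ∃ A' C', U = .arrow Y A' C' ∧ Eqv A A' ∧ Eqv C C' := h.arrow_iff_aux.1 _ _ _ rfl

theorem all_iff_aux {T U : Ty} (h : Eqv T U) :
    (∀ Y K C, T = .all Y K C → ∃ C', U = .all Y K C' ∧ Eqv C C') ∧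
    (∀ Y K C, U = .all Y K C → ∃ C', T = .all Y K C' ∧ Eqv C C') := by
  induction h with
  | refl T => exact ⟨fun _ _ _ h => ⟨_, h, .refl _⟩, fun _ _ _ h => ⟨_, h, .refl _⟩⟩
  | symm _ ih => exact ih.symm
  | trans _ _ ih₁ ih₂ =>
    constructor
    · intro Y A C h
      obtain ⟨_, h, hC⟩ := ih₁.1 _ _ _ h
      obtain ⟨_, h, hC'⟩ := ih₂.1 _ _ _ h
      exact ⟨_, h, hC.trans hC'⟩
    · intro Y A C h
      obtain ⟨_, h, hC⟩ := ih₂.2 _ _ _ h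
      obtain ⟨_, h, hC'⟩ := ih₁.2 _ _ _ h
      exact ⟨_, h, hC.trans hC'⟩
  | all hC =>
    constructor <;> rintro Y A C ⟨⟩
    · exact ⟨_, rfl, hC⟩
    · exact ⟨_, rfl, hC.symm⟩
  | absent hR => constructor <;> rintro Y A C ⟨⟩; cases hR
  | _ => constructor <;> rintro Y A C ⟨⟩

theorem all_inv {Y : Lin} {K : Kind} {C U : Ty} (h : Eqv (.all Y K C) U) :
    ∃ C', U = .all Y K C' ∧ Eqv C C' := h.all_iff_aux.1 _ _ _ rfl

theorem comp_iff_aux {T U : Ty} (h : Eqv T U) :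
    (∀ A E, T = .comp A E → ∃ A' E', U = .comp A' E' ∧ Eqv A A' ∧ Eqv E E') ∧
    (∀ A E, U = .comp A E → ∃ A' E', T = .comp A' E' ∧ Eqv A A' ∧ Eqv E E') := by
  induction h with
  | refl T => exact ⟨fun _ _ h => ⟨_, _, h, .refl _, .refl _⟩,
      fun _ _ h => ⟨_, _, h, .refl _, .refl _⟩⟩
  | symm _ ih => exact ih.symm
  | trans _ _ ih₁ ih₂ =>
    constructor
    · intro A C h
      obtain ⟨_, _, h, hA, hC⟩ := ih₁.1 _ _ h
      obtain ⟨_, _, h, hA', hC'⟩ := ih₂.1 _ _ h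
      exact ⟨_, _, h, hA.trans hA', hC.trans hC'⟩
    · intro A C h
      obtain ⟨_, _, h, hA, hC⟩ := ih₂.2 _ _ h
      obtain ⟨_, _, h, hA', hC'⟩ := ih₁.2 _ _ h
      exact ⟨_, _, h, hA.trans hA', hC.trans hC'⟩
  | comp hA hC =>
    constructor <;> rintro A C ⟨⟩
    · exact ⟨_, _, rfl, hA, hC⟩
    · exact ⟨_, _, rfl, hA.symm, hC.symm⟩
  | absent hR => constructor <;> rintro A C ⟨⟩; cases hR
  | _ => constructor <;> rintro A C ⟨⟩

theorem comp_inv {A E U : Ty} (h : Eqv (.comp A E) U) :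
    ∃ A' E', U = .comp A' E' ∧ Eqv A A' ∧ Eqv E E' := h.comp_iff_aux.1 _ _ rfl

theorem eff_iff_aux {T U : Ty} (h : Eqv T U) :
    (∀ R, T = .eff R → ∃ R', U = .eff R' ∧ Eqv R R') ∧
    (∀ R, U = .eff R → ∃ R', T = .eff R' ∧ Eqv R R') := by
  induction h with
  | refl T => exact ⟨fun _ h => ⟨_, h, .refl _⟩, fun _ h => ⟨_, h, .refl _⟩⟩
  | symm _ ih => exact ih.symm
  | trans _ _ ih₁ ih₂ =>
    constructor
    · intro R h
      obtain ⟨_, h, hC⟩ := ih₁.1 _ h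
      obtain ⟨_, h, hC'⟩ := ih₂.1 _ h
      exact ⟨_, h, hC.trans hC'⟩
    · intro R h
      obtain ⟨_, h, hC⟩ := ih₂.2 _ h
      obtain ⟨_, h, hC'⟩ := ih₁.2 _ h
      exact ⟨_, h, hC.trans hC'⟩
  | eff hC =>
    constructor <;> rintro R ⟨⟩
    · exact ⟨_, rfl, hC⟩
    · exact ⟨_, rfl, hC.symm⟩
  | absent hR => constructor <;> rintro R ⟨⟩; cases hR
  | _ => constructor <;> rintro R ⟨⟩

theorem eff_inv {R U : Ty} (h : Eqv (.eff R) U) : ∃ R', U = .eff R' ∧ Eqv R R' :=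
  h.eff_iff_aux.1 _ rfl

theorem op_iff_aux {T U : Ty} (h : Eqv T U) :
    (∀ Y A B, T = .op Y A B → ∃ A' B', U = .op Y A' B' ∧ Eqv A A' ∧ Eqv B B') ∧
    (∀ Y A B, U = .op Y A B → ∃ A' B', T = .op Y A' B' ∧ Eqv A A' ∧ Eqv B B') := by
  induction h with
  | refl T => exact ⟨fun _ _ _ h => ⟨_, _, h, .refl _, .refl _⟩,
      fun _ _ _ h => ⟨_, _, h, .refl _, .refl _⟩⟩
  | symm _ ih => exact ih.symm
  | trans _ _ ih₁ ih₂ =>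
    constructor
    · intro Y A C h
      obtain ⟨_, _, h, hA, hC⟩ := ih₁.1 _ _ _ h
      obtain ⟨_, _, h, hA', hC'⟩ := ih₂.1 _ _ _ h
      exact ⟨_, _, h, hA.trans hA', hC.trans hC'⟩
    · intro Y A C h
      obtain ⟨_, _, h, hA, hC⟩ := ih₂.2 _ _ _ h
      obtain ⟨_, _, h, hA', hC'⟩ := ih₁.2 _ _ _ h
      exact ⟨_, _, h, hA.trans hA', hC.trans hC'⟩
  | op hA hC =>
    constructor <;> rintro Y A C ⟨⟩
    · exact ⟨_, _, rfl, hA, hC⟩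
    · exact ⟨_, _, rfl, hA.symm, hC.symm⟩
  | absent hR => constructor <;> rintro Y A C ⟨⟩; cases hR
  | _ => constructor <;> rintro Y A C ⟨⟩

theorem op_inv {Y : Lin} {A B U : Ty} (h : Eqv (.op Y A B) U) :
    ∃ A' B', U = .op Y A' B' ∧ Eqv A A' ∧ Eqv B B' := h.op_iff_aux.1 _ _ _ rfl

/-- Restricted to entries of the form `op`: the rule `absent` inserts or deletes only `abs`. The
linearity is preserved exactly, the argument and result types only up to identification. -/
theorem rowMem_iff_aux {R R' : Ty} (h : Eqv R R') (l : Label) :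
    (∀ Y A B, RowMem l (Ty.op Y A B) R →
      ∃ A' B', RowMem l (Ty.op Y A' B') R' ∧ Eqv A A' ∧ Eqv B B') ∧
    (∀ Y A B, RowMem l (Ty.op Y A B) R' →
      ∃ A' B', RowMem l (Ty.op Y A' B') R ∧ Eqv A A' ∧ Eqv B B') := by
  induction h with
  | refl T => exact ⟨fun _ _ _ h => ⟨_, _, h, .refl _, .refl _⟩,
      fun _ _ _ h => ⟨_, _, h, .refl _, .refl _⟩⟩
  | symm _ ih => exact ih.symm
  | trans _ _ ih₁ ih₂ =>
    constructor
    · intro Y A C h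
      obtain ⟨_, _, h, hA, hC⟩ := ih₁.1 _ _ _ h
      obtain ⟨_, _, h, hA', hC'⟩ := ih₂.1 _ _ _ h
      exact ⟨_, _, h, hA.trans hA', hC.trans hC'⟩
    · intro Y A C h
      obtain ⟨_, _, h, hA, hC⟩ := ih₂.2 _ _ _ h
      obtain ⟨_, _, h, hA', hC'⟩ := ih₁.2 _ _ _ h
      exact ⟨_, _, h, hA.trans hA', hC.trans hC'⟩
  | rowCons hP _ _ ih =>
    constructor
    · intro Y A B h
      cases h with
      | here => obtain ⟨_, _, rfl, hA, hB⟩ := hP.op_inv; exact ⟨_, _, .here, hA, hB⟩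
      | there h => obtain ⟨_, _, h, hA, hB⟩ := ih.1 _ _ _ h; exact ⟨_, _, .there h, hA, hB⟩
    · intro Y A B h
      cases h with
      | here => obtain ⟨_, _, rfl, hA, hB⟩ := hP.symm.op_inv; exact ⟨_, _, .here, hA, hB⟩
      | there h => obtain ⟨_, _, h, hA, hB⟩ := ih.2 _ _ _ h; exact ⟨_, _, .there h, hA, hB⟩
  | swap _ =>
    constructor <;> intro Y A B h <;> refine ⟨A, B, ?_, .refl _, .refl _⟩
    all_goals
      rcases h with _ | h
      · exact .there .here
      · rcases h with _ | h
        · exact .here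
        · exact .there (.there h)
  | absent _ =>
    constructor <;> intro Y A B h <;> refine ⟨A, B, ?_, .refl _, .refl _⟩
    · cases h with | there h => exact h
    · exact .there h
  | _ => constructor <;> rintro Y A C ⟨⟩

theorem rowMem {R R' : Ty} (h : Eqv R R') {l : Label} {Y : Lin} {A B : Ty}
    (hm : RowMem l (.op Y A B) R) :
    ∃ A' B', RowMem l (.op Y A' B') R' ∧ Eqv A A' ∧ Eqv B B' :=
  (h.rowMem_iff_aux l).1 _ _ _ hm

end Eqv

/-! ### Renaming and substitution in types -/

theorem upSubst_var : upSubst var = var := by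
  funext n; cases n <;> rfl

theorem subst_var (T : Ty) : T.subst var = T := by
  induction T <;> simp_all [subst, upSubst_var]

theorem rename_eq_subst (T : Ty) (ξ : ℕ → ℕ) : T.rename ξ = T.subst (fun n => var (ξ n)) := by
  induction T generalizing ξ with
  | all Y K C ih =>
    simp only [rename, subst, ih]
    congr 2; funext n; cases n <;> rfl
  | _ => simp_all [rename, subst]

theorem subst_rename (T : Ty) (ξ : ℕ → ℕ) (σ : ℕ → Ty) :
    (T.rename ξ).subst σ = T.subst (fun n => σ (ξ n)) := by
  induction T generalizing ξ σ with
  | all Y K C ih =>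
    simp only [rename, subst, ih]
    congr 2; funext n; cases n <;> rfl
  | _ => simp_all [rename, subst]

theorem rename_rename (T : Ty) (ξ ζ : ℕ → ℕ) :
    (T.rename ξ).rename ζ = T.rename (fun n => ζ (ξ n)) := by
  rw [rename_eq_subst (T.rename ξ), subst_rename, rename_eq_subst]

theorem rename_subst (T : Ty) (σ : ℕ → Ty) (ξ : ℕ → ℕ) :
    (T.subst σ).rename ξ = T.subst (fun n => (σ n).rename ξ) := by
  induction T generalizing ξ σ with
  | all Y K C ih =>
    simp only [rename, subst, ih]
    congr 2; funext n
    cases n with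
    | zero => rfl
    | succ n => simp only [upSubst, rename_rename]; rfl
  | _ => simp_all [rename, subst]

theorem subst_subst (T : Ty) (σ τ : ℕ → Ty) :
    (T.subst σ).subst τ = T.subst (fun n => (σ n).subst τ) := by
  induction T generalizing σ τ with
  | all Y K C ih =>
    simp only [subst, ih]
    congr 2; funext n
    cases n with
    | zero => rfl
    | succ n => simp only [upSubst, subst_rename, rename_subst]
  | _ => simp_all [subst]

theorem subst_upSubst_shift (T : Ty) (τ : ℕ → Ty) :
    (T.rename Nat.succ).subst (upSubst τ) = (T.subst τ).rename Nat.succ := by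
  rw [subst_rename, rename_subst]; rfl

theorem inst_subst (C T : Ty) (τ : ℕ → Ty) :
    (C.inst T).subst τ = (C.subst (upSubst τ)).inst (T.subst τ) := by
  simp only [inst, subst_subst]
  congr 1; funext n
  cases n with
  | zero => rfl
  | succ n =>
    simp only [upSubst, subst_rename]
    exact (subst_var _).symm

theorem IsClosedRow.subst {R : Ty} (h : IsClosedRow R) (τ : ℕ → Ty) :
    IsClosedRow (R.subst τ) := by
  induction h with
  | nil => exact .nil
  | cons _ ih => exact .cons ih

theorem Eqv.subst {T U : Ty} (h : Eqv T U) (τ : ℕ → Ty) : Eqv (T.subst τ) (U.subst τ) := by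
  induction h generalizing τ with
  | refl => exact .refl _
  | symm _ ih => exact (ih τ).symm
  | trans _ _ ih₁ ih₂ => exact (ih₁ τ).trans (ih₂ τ)
  | arrow _ _ ih₁ ih₂ => exact .arrow (ih₁ τ) (ih₂ τ)
  | all _ ih => exact .all (ih _)
  | comp _ _ ih₁ ih₂ => exact .comp (ih₁ τ) (ih₂ τ)
  | eff _ ih => exact .eff (ih τ)
  | rowCons _ _ ih₁ ih₂ => exact .rowCons (ih₁ τ) (ih₂ τ)
  | op _ _ ih₁ ih₂ => exact .op (ih₁ τ) (ih₂ τ)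
  | handler _ _ ih₁ ih₂ => exact .handler (ih₁ τ) (ih₂ τ)
  | swap h => exact .swap h
  | absent h => exact .absent (h.subst τ)

/-- Substitution in the signatures of a handler. -/
def substSigs (τ : ℕ → Ty) (sigs : List (Label × Lin × Ty × Ty)) : List (Label × Lin × Ty × Ty) :=
  sigs.map fun s => (s.1, s.2.1, s.2.2.1.subst τ, s.2.2.2.subst τ)

theorem subst_opsRow (τ : ℕ → Ty) (sigs : List (Label × Lin × Ty × Ty)) (R : Ty) :
    (opsRow sigs R).subst τ = opsRow (substSigs τ sigs) (R.subst τ) := by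
  induction sigs with
  | nil => rfl
  | cons s sigs ih => simp only [opsRow, subst, ih]; rfl

theorem subst_presRow (τ : ℕ → Ty) (sigs : List (Label × Lin × Ty × Ty)) (P R : Ty) :
    (presRow sigs P R).subst τ = presRow (substSigs τ sigs) (P.subst τ) (R.subst τ) := by
  induction sigs with
  | nil => rfl
  | cons s sigs ih => simp only [presRow, subst, ih]; rfl

end Ty

-- Kinding under renaming, substitution and extension of the kind context.

namespace Kinding

theorem rename {Δ Δ' : KCtx} {T : Ty} {K : Kind} (h : Kinding Δ T K) {ξ : ℕ → ℕ}
    (hξ : ∀ n K, Δ[n]? = some K → Δ'[ξ n]? = some K) : Kinding Δ' (T.rename ξ) K := by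
  induction h generalizing Δ' ξ with
  | var hn hK => exact .var (hξ _ _ hn) hK
  | all _ ih =>
    refine .all (ih ?_)
    rintro (_ | n) K h
    · exact h
    · exact hξ n K h
  | arrow _ _ ih₁ ih₂ => exact .arrow (ih₁ hξ) (ih₂ hξ)
  | comp _ _ ih₁ ih₂ => exact .comp (ih₁ hξ) (ih₂ hξ)
  | eff _ ih => exact .eff (ih hξ)
  | op _ _ ih₁ ih₂ => exact .op (ih₁ hξ) (ih₂ hξ)
  | abs => exact .abs
  | rowNil => exact .rowNil
  | rowCons _ hl _ ih₁ ih₂ => exact .rowCons (ih₁ hξ) hl (ih₂ hξ)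
  | handler _ _ ih₁ ih₂ => exact .handler (ih₁ hξ) (ih₂ hξ)
  | upcast _ hs ih => exact .upcast (ih hξ) hs

theorem shift {Δ : KCtx} {T : Ty} {K : Kind} (h : Kinding Δ T K) (K' : Kind) :
    Kinding (K' :: Δ) (T.rename Nat.succ) K := h.rename fun _ _ h => h

/-- `τ` maps the variables of `Δ` to types of the same kind over `Δ'`. -/
def Subst (Δ Δ' : KCtx) (τ : ℕ → Ty) : Prop :=
  ∀ n K, Δ[n]? = some K → K.HasVars → Kinding Δ' (τ n) K

theorem Subst.up {Δ Δ' : KCtx} {τ : ℕ → Ty} (h : Subst Δ Δ' τ) (K : Kind) :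
    Subst (K :: Δ) (K :: Δ') (Ty.upSubst τ) := by
  rintro (_ | n) K' hn hK
  · exact .var hn hK
  · exact (h n K' hn hK).shift K

theorem Subst.single {Δ : KCtx} {T : Ty} {K : Kind} (h : Kinding Δ T K) :
    Subst (K :: Δ) Δ (Ty.single T) := by
  rintro (_ | n) K' hn hK
  · cases hn; exact h
  · exact .var hn hK

theorem subst {Δ Δ' : KCtx} {T : Ty} {K : Kind} (h : Kinding Δ T K) {τ : ℕ → Ty}
    (hτ : Subst Δ Δ' τ) : Kinding Δ' (T.subst τ) K := by
  induction h generalizing Δ' τ with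
  | var hn hK => exact hτ _ _ hn hK
  | all _ ih => exact .all (ih (hτ.up _))
  | arrow _ _ ih₁ ih₂ => exact .arrow (ih₁ hτ) (ih₂ hτ)
  | comp _ _ ih₁ ih₂ => exact .comp (ih₁ hτ) (ih₂ hτ)
  | eff _ ih => exact .eff (ih hτ)
  | op _ _ ih₁ ih₂ => exact .op (ih₁ hτ) (ih₂ hτ)
  | abs => exact .abs
  | rowNil => exact .rowNil
  | rowCons _ hl _ ih₁ ih₂ => exact .rowCons (ih₁ hτ) hl (ih₂ hτ)
  | handler _ _ ih₁ ih₂ => exact .handler (ih₁ hτ) (ih₂ hτ)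
  | upcast _ hs ih => exact .upcast (ih hτ) hs

theorem inst {Δ : KCtx} {C T : Ty} {K K' : Kind} (hC : Kinding (K :: Δ) C K')
    (hT : Kinding Δ T K) : Kinding Δ (C.inst T) K' := hC.subst (.single hT)

/-- New kind variables are added at the outer end, where de Bruijn indices of `T` are unaffected;
hence `T` appears without a renaming. -/
theorem append {Δ : KCtx} {T : Ty} {K : Kind} (h : Kinding Δ T K) (Δ' : KCtx) :
    Kinding (Δ ++ Δ') T K := by
  induction h with
  | var hn hK =>
    exact .var (by rw [List.getElem?_append_left (List.getElem?_eq_some_iff.1 hn).1, hn]) hK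
  | all _ ih => exact .all ih
  | arrow _ _ ih₁ ih₂ => exact .arrow ih₁ ih₂
  | comp _ _ ih₁ ih₂ => exact .comp ih₁ ih₂
  | eff _ ih => exact .eff ih
  | op _ _ ih₁ ih₂ => exact .op ih₁ ih₂
  | abs => exact .abs
  | rowNil => exact .rowNil
  | rowCons _ hl _ ih₁ ih₂ => exact .rowCons ih₁ hl ih₂
  | handler _ _ ih₁ ih₂ => exact .handler ih₁ ih₂
  | upcast _ hs ih => exact .upcast ih hs

/-- A well-kinded type mentions only variables below `Δ.length`. For `Δ = []` this says that closed
types are fixed by every substitution. -/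
theorem subst_eq {Δ : KCtx} {T : Ty} {K : Kind} (h : Kinding Δ T K) {τ : ℕ → Ty}
    (hτ : ∀ n < Δ.length, τ n = .var n) : T.subst τ = T := by
  induction h generalizing τ with
  | var hn hK => exact hτ _ (List.getElem?_eq_some_iff.1 hn).1
  | all _ ih =>
    refine congrArg _ (ih ?_)
    rintro (_ | n) hn
    · rfl
    · rw [Ty.upSubst, hτ n (Nat.lt_of_succ_lt_succ hn)]; rfl
  | _ => simp_all [Ty.subst]

theorem rename_eq {Δ : KCtx} {T : Ty} {K : Kind} (h : Kinding Δ T K) {ξ : ℕ → ℕ}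
    (hξ : ∀ n < Δ.length, ξ n = n) : T.rename ξ = T := by
  rw [Ty.rename_eq_subst]
  exact h.subst_eq fun n hn => congrArg _ (hξ n hn)

end Kinding

/-! ### Contexts -/

theorem CtxLin.append {Δ : KCtx} {Γ : Ctx} {Y : Lin} (h : CtxLin Δ Γ Y) {Δ' : KCtx} {Γ' : Ctx}
    (h' : CtxLin (Δ ++ Δ') Γ' .unl) : CtxLin (Δ ++ Δ') (Γ ++ Γ') Y := by
  intro A hA
  rcases List.mem_append.1 hA with hA | hA
  · exact (h A hA).append Δ'
  · exact (h' A hA).of_unl Y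

theorem CtxLin.tshift {Δ : KCtx} {Γ : Ctx} {Y : Lin} (h : CtxLin Δ Γ Y) (K : Kind) :
    CtxLin (K :: Δ) (Ctx.tshift Γ) Y := by
  intro A hA
  obtain ⟨B, hB, hBA⟩ := List.mem_map.1 hA
  cases B with
  | none => cases hBA
  | some B => cases hBA; exact (h B hB).shift K

theorem CtxLin.take {Δ : KCtx} {Γ : Ctx} {Y : Lin} (h : CtxLin Δ Γ Y) (k : ℕ) :
    CtxLin Δ (Γ.take k) Y := fun A hA => h A (List.mem_of_mem_take hA)

theorem CtxLin.nil {Δ : KCtx} {Y : Lin} : CtxLin Δ [] Y := fun _ h => nomatch h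

namespace Split

theorem self {Δ : KCtx} {Γ : Ctx} (h : CtxLin Δ Γ .unl) : Split Δ Γ Γ Γ := by
  induction Γ with
  | nil => exact .nil
  | cons A Γ ih =>
    have ih := ih fun B hB => h B (List.mem_cons_of_mem _ hB)
    cases A with
    | none => exact .none ih
    | some A => exact .unl (h A List.mem_cons_self) ih

theorem append {Δ : KCtx} {Γ Γ₁ Γ₂ : Ctx} (h : Split Δ Γ Γ₁ Γ₂) {Δ' : KCtx} {Γ' : Ctx}
    (h' : CtxLin (Δ ++ Δ') Γ' .unl) : Split (Δ ++ Δ') (Γ ++ Γ') (Γ₁ ++ Γ') (Γ₂ ++ Γ') := by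
  induction h with
  | nil => exact self h'
  | none _ ih => exact .none ih
  | unl hA _ ih => exact .unl (hA.append Δ') ih
  | linLeft hA _ ih => exact .linLeft (hA.append Δ') ih
  | linRight hA _ ih => exact .linRight (hA.append Δ') ih

theorem take {Δ : KCtx} {Γ Γ₁ Γ₂ : Ctx} (h : Split Δ Γ Γ₁ Γ₂) (k : ℕ) :
    Split Δ (Γ.take k) (Γ₁.take k) (Γ₂.take k) := by
  induction h generalizing k with
  | nil => simpa using Split.nil
  | none _ ih => cases k with
    | zero => exact .nil
    | succ k => exact .none (ih k)
  | unl hA _ ih => cases k with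
    | zero => exact .nil
    | succ k => exact .unl hA (ih k)
  | linLeft hA _ ih => cases k with
    | zero => exact .nil
    | succ k => exact .linLeft hA (ih k)
  | linRight hA _ ih => cases k with
    | zero => exact .nil
    | succ k => exact .linRight hA (ih k)

theorem length {Δ : KCtx} {Γ Γ₁ Γ₂ : Ctx} (h : Split Δ Γ Γ₁ Γ₂) :
    Γ₁.length = Γ.length ∧ Γ₂.length = Γ.length := by
  induction h <;> simp_all

theorem get_left {Δ : KCtx} {Γ Γ₁ Γ₂ : Ctx} (h : Split Δ Γ Γ₁ Γ₂) {n : ℕ} {A : Ty}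
    (hA : Γ₁[n]? = some (some A)) : Γ[n]? = some (some A) := by
  induction h generalizing n with
  | nil => exact hA
  | _ => cases n <;> simp_all

theorem get_right {Δ : KCtx} {Γ Γ₁ Γ₂ : Ctx} (h : Split Δ Γ Γ₁ Γ₂) {n : ℕ} {A : Ty}
    (hA : Γ₂[n]? = some (some A)) : Γ[n]? = some (some A) := by
  induction h generalizing n with
  | nil => exact hA
  | _ => cases n <;> simp_all

theorem subst {Δ Δ' : KCtx} {Γ Γ₁ Γ₂ : Ctx} (h : Split Δ Γ Γ₁ Γ₂) {τ : ℕ → Ty}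
    (hτ : Kinding.Subst Δ Δ' τ) :
    Split Δ' (Γ.map (Option.map (Ty.subst τ))) (Γ₁.map (Option.map (Ty.subst τ)))
      (Γ₂.map (Option.map (Ty.subst τ))) := by
  induction h with
  | nil => exact .nil
  | none _ ih => exact .none ih
  | unl hA _ ih => exact .unl (hA.subst hτ) ih
  | linLeft hA _ ih => exact .linLeft (hA.subst hτ) ih
  | linRight hA _ ih => exact .linRight (hA.subst hτ) ih

theorem nil_inv {Δ : KCtx} {Γ₁ Γ₂ : Ctx} (h : Split Δ [] Γ₁ Γ₂) : Γ₁ = [] ∧ Γ₂ = [] := by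
  cases h; exact ⟨rfl, rfl⟩

end Split

/-! ### Regularity -/

theorem HndTy.kinding {Δ : KCtx} {Γ : Ctx} {H : Hnd} {C D : Ty} :
    HndTy Δ Γ H C D → Kinding Δ D .comp
  | .handler _ _ h _ => h

mutual
theorem ValTy.kinding {Δ : KCtx} {Γ : Ctx} {V : Val} {A : Ty} :
    ValTy Δ Γ V A → Kinding Δ A (.type .lin)
  | .var _ h _ => h
  | .lam _ h h' => (Kinding.arrow h h'.kinding).to_lin
  | .tlam _ h => (Kinding.all h.kinding).to_lin
  | .tag h => h.kinding
  | .conv _ _ h => h.to_lin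
theorem CompTy.kinding {Δ : KCtx} {Γ : Ctx} {M : Comp} {C : Ty} :
    CompTy Δ Γ M C → Kinding Δ C .comp
  | .app _ h _ => h.kinding.arrow_inv.2.2
  | .tapp h hT => h.kinding.all_inv.2.inst hT
  | .ret h hE => .comp h.kinding hE
  | .perform _ h hE _ => by
    obtain ⟨-, _, h⟩ := h.eff_inv
    obtain ⟨_, _, -, -, h, -⟩ := h.rowCons_inv
    exact .comp h.op_inv.2.2 hE
  | .bind _ _ h _ _ => h.kinding
  | .handle _ h _ => h.kinding
  | .conv _ _ h => h
end

/-! ### Inversion -/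

/-- Any number of `conv` steps may sit above the syntax-directed rule; they compose to one
identification. The subject is generalized to `V₀` with an equation so that recursion on the mutual
derivation applies. The inversion lemmas below share this form. -/
theorem ValTy.lam_inv_aux {Δ : KCtx} {Γ : Ctx} {Y : Lin} {A : Ty} {M : Comp} {B : Ty}
    {V₀ : Val} : ValTy Δ Γ V₀ B → V₀ = .lam Y A M → ∃ C, Ty.Eqv (.arrow Y A C) B ∧ CtxLin Δ Γ Y ∧
      Kinding Δ A (.type .lin) ∧ CompTy Δ (some A :: Γ) M C
  | .lam h hA hM, rfl => ⟨_, .refl _, h, hA.to_lin, hM⟩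
  | .conv h e _, rfl => by
    obtain ⟨C, e', h⟩ := h.lam_inv_aux rfl
    exact ⟨C, e'.trans e, h⟩

theorem ValTy.lam_inv {Δ : KCtx} {Γ : Ctx} {Y : Lin} {A : Ty} {M : Comp} {B : Ty}
    (h : ValTy Δ Γ (.lam Y A M) B) : ∃ C, Ty.Eqv (.arrow Y A C) B ∧ CtxLin Δ Γ Y ∧
      Kinding Δ A (.type .lin) ∧ CompTy Δ (some A :: Γ) M C :=
  h.lam_inv_aux rfl

theorem ValTy.tlam_inv_aux {Δ : KCtx} {Γ : Ctx} {Y : Lin} {K : Kind} {M : Comp} {B : Ty}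
    {V₀ : Val} : ValTy Δ Γ V₀ B → V₀ = .tlam Y K M → ∃ C, Ty.Eqv (.all Y K C) B ∧ CtxLin Δ Γ Y ∧
      CompTy (K :: Δ) (Ctx.tshift Γ) M C
  | .tlam h hM, rfl => ⟨_, .refl _, h, hM⟩
  | .conv h e _, rfl => by
    obtain ⟨C, e', h⟩ := h.tlam_inv_aux rfl
    exact ⟨C, e'.trans e, h⟩

theorem ValTy.tlam_inv {Δ : KCtx} {Γ : Ctx} {Y : Lin} {K : Kind} {M : Comp} {B : Ty}
    (h : ValTy Δ Γ (.tlam Y K M) B) : ∃ C, Ty.Eqv (.all Y K C) B ∧ CtxLin Δ Γ Y ∧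
      CompTy (K :: Δ) (Ctx.tshift Γ) M C :=
  h.tlam_inv_aux rfl

theorem ValTy.tag_inv_aux {Δ : KCtx} {Γ : Ctx} {V : Val} {B : Ty}
    {V₀ : Val} : ValTy Δ Γ V₀ B → V₀ = .tag V → ValTy Δ Γ V B
  | .tag h, rfl => h
  | .conv h e hB, rfl => .conv (h.tag_inv_aux rfl) e hB

theorem ValTy.tag_inv {Δ : KCtx} {Γ : Ctx} {V : Val} {B : Ty}
    (h : ValTy Δ Γ (.tag V) B) : ValTy Δ Γ V B :=
  h.tag_inv_aux rfl

theorem ValTy.var_inv_aux {Δ : KCtx} {Γ : Ctx} {n : ℕ} {B : Ty}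
    {V₀ : Val} : ValTy Δ Γ V₀ B → V₀ = .var n → ∃ A, Γ[n]? = some (some A)
  | .var h _ _, rfl => ⟨_, h⟩
  | .conv h _ _, rfl => h.var_inv_aux rfl

theorem ValTy.var_inv {Δ : KCtx} {Γ : Ctx} {n : ℕ} {B : Ty}
    (h : ValTy Δ Γ (.var n) B) : ∃ A, Γ[n]? = some (some A) :=
  h.var_inv_aux rfl

theorem CompTy.app_inv_aux {Δ : KCtx} {Γ : Ctx} {V W : Val} {D : Ty}
    {M₀ : Comp} : CompTy Δ Γ M₀ D →
    M₀ = .app V W → ∃ Γ₁ Γ₂ Y A C, Split Δ Γ Γ₁ Γ₂ ∧ ValTy Δ Γ₁ V (.arrow Y A C) ∧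
      ValTy Δ Γ₂ W A ∧ Ty.Eqv C D
  | .app hs hV hW, rfl => ⟨_, _, _, _, _, hs, hV, hW, .refl _⟩
  | .conv h e _, rfl => by
    obtain ⟨_, _, _, _, _, hs, hV, hW, e'⟩ := h.app_inv_aux rfl
    exact ⟨_, _, _, _, _, hs, hV, hW, e'.trans e⟩

theorem CompTy.app_inv {Δ : KCtx} {Γ : Ctx} {V W : Val} {D : Ty}
    (h : CompTy Δ Γ (.app V W) D) : ∃ Γ₁ Γ₂ Y A C, Split Δ Γ Γ₁ Γ₂ ∧ ValTy Δ Γ₁ V (.arrow Y A C) ∧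
      ValTy Δ Γ₂ W A ∧ Ty.Eqv C D :=
  h.app_inv_aux rfl

theorem CompTy.tapp_inv_aux {Δ : KCtx} {Γ : Ctx} {V : Val} {T D : Ty}
    {M₀ : Comp} : CompTy Δ Γ M₀ D →
    M₀ = .tapp V T → ∃ Y K C, ValTy Δ Γ V (.all Y K C) ∧ Kinding Δ T K ∧
      Ty.Eqv (C.inst T) D
  | .tapp hV hT, rfl => ⟨_, _, _, hV, hT, .refl _⟩
  | .conv h e _, rfl => by
    obtain ⟨_, _, _, hV, hT, e'⟩ := h.tapp_inv_aux rfl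
    exact ⟨_, _, _, hV, hT, e'.trans e⟩

theorem CompTy.tapp_inv {Δ : KCtx} {Γ : Ctx} {V : Val} {T D : Ty}
    (h : CompTy Δ Γ (.tapp V T) D) : ∃ Y K C, ValTy Δ Γ V (.all Y K C) ∧ Kinding Δ T K ∧
      Ty.Eqv (C.inst T) D :=
  h.tapp_inv_aux rfl

theorem CompTy.ret_inv_aux {Δ : KCtx} {Γ : Ctx} {V : Val} {E D : Ty}
    {M₀ : Comp} : CompTy Δ Γ M₀ D →
    M₀ = .ret V E → ∃ A, ValTy Δ Γ V A ∧ Kinding Δ E .effect ∧ Ty.Eqv (.comp A E) D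
  | .ret hV hE, rfl => ⟨_, hV, hE, .refl _⟩
  | .conv h e _, rfl => by
    obtain ⟨_, hV, hE, e'⟩ := h.ret_inv_aux rfl
    exact ⟨_, hV, hE, e'.trans e⟩

theorem CompTy.ret_inv {Δ : KCtx} {Γ : Ctx} {V : Val} {E D : Ty}
    (h : CompTy Δ Γ (.ret V E) D) :
    ∃ A, ValTy Δ Γ V A ∧ Kinding Δ E .effect ∧ Ty.Eqv (.comp A E) D :=
  h.ret_inv_aux rfl

theorem CompTy.perform_inv_aux {Δ : KCtx} {Γ : Ctx} {l : Label} {V : Val} {E D : Ty}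
    {M₀ : Comp} : CompTy Δ Γ M₀ D →
    M₀ = .perform l V E → ∃ Y A B R, Ty.Eqv E (.eff (.rowCons l (.op Y A B) R)) ∧
      Kinding Δ (.eff (.rowCons l (.op Y A B) R)) .effect ∧ Kinding Δ E .effect ∧
      ValTy Δ Γ V A ∧ Ty.Eqv (.comp B E) D
  | .perform e h hE hV, rfl => ⟨_, _, _, _, e, h, hE, hV, .refl _⟩
  | .conv h e _, rfl => by
    obtain ⟨_, _, _, _, h₁, h₂, h₃, h₄, e'⟩ := h.perform_inv_aux rfl
    exact ⟨_, _, _, _, h₁, h₂, h₃, h₄, e'.trans e⟩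

theorem CompTy.perform_inv {Δ : KCtx} {Γ : Ctx} {l : Label} {V : Val} {E D : Ty}
    (h : CompTy Δ Γ (.perform l V E) D) : ∃ Y A B R, Ty.Eqv E (.eff (.rowCons l (.op Y A B) R)) ∧
      Kinding Δ (.eff (.rowCons l (.op Y A B) R)) .effect ∧ Kinding Δ E .effect ∧
      ValTy Δ Γ V A ∧ Ty.Eqv (.comp B E) D :=
  h.perform_inv_aux rfl

theorem CompTy.bind_inv_aux {Δ : KCtx} {Γ : Ctx} {Y : Lin} {M N : Comp} {D : Ty}
    {M₀ : Comp} : CompTy Δ Γ M₀ D →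
    M₀ = .bind Y M N → ∃ Γ₁ Γ₂ A B R, Split Δ Γ Γ₁ Γ₂ ∧
      CompTy Δ Γ₁ M (.comp A (.eff R)) ∧ CompTy Δ (some A :: Γ₂) N (.comp B (.eff R)) ∧
      CtxLin Δ Γ₂ Y ∧ Kinding Δ R (.row ∅ Y) ∧ Ty.Eqv (.comp B (.eff R)) D
  | .bind h₁ h₂ h₃ h₄ h₅, rfl => ⟨_, _, _, _, _, h₁, h₂, h₃, h₄, h₅, .refl _⟩
  | .conv h e _, rfl => by
    obtain ⟨_, _, _, _, _, h₁, h₂, h₃, h₄, h₅, e'⟩ := h.bind_inv_aux rfl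
    exact ⟨_, _, _, _, _, h₁, h₂, h₃, h₄, h₅, e'.trans e⟩

theorem CompTy.bind_inv {Δ : KCtx} {Γ : Ctx} {Y : Lin} {M N : Comp} {D : Ty}
    (h : CompTy Δ Γ (.bind Y M N) D) : ∃ Γ₁ Γ₂ A B R, Split Δ Γ Γ₁ Γ₂ ∧
      CompTy Δ Γ₁ M (.comp A (.eff R)) ∧ CompTy Δ (some A :: Γ₂) N (.comp B (.eff R)) ∧
      CtxLin Δ Γ₂ Y ∧ Kinding Δ R (.row ∅ Y) ∧ Ty.Eqv (.comp B (.eff R)) D :=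
  h.bind_inv_aux rfl

theorem CompTy.handle_inv_aux {Δ : KCtx} {Γ : Ctx} {M : Comp} {H : Hnd} {D' : Ty}
    {M₀ : Comp} : CompTy Δ Γ M₀ D' →
    M₀ = .handle M H → ∃ Γ₁ Γ₂ C D, Split Δ Γ Γ₁ Γ₂ ∧ HndTy Δ Γ₁ H C D ∧
      CompTy Δ Γ₂ M C ∧ Ty.Eqv D D'
  | .handle h₁ h₂ h₃, rfl => ⟨_, _, _, _, h₁, h₂, h₃, .refl _⟩
  | .conv h e _, rfl => by
    obtain ⟨_, _, _, _, h₁, h₂, h₃, e'⟩ := h.handle_inv_aux rfl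
    exact ⟨_, _, _, _, h₁, h₂, h₃, e'.trans e⟩

theorem CompTy.handle_inv {Δ : KCtx} {Γ : Ctx} {M : Comp} {H : Hnd} {D' : Ty}
    (h : CompTy Δ Γ (.handle M H) D') : ∃ Γ₁ Γ₂ C D, Split Δ Γ Γ₁ Γ₂ ∧ HndTy Δ Γ₁ H C D ∧
      CompTy Δ Γ₂ M C ∧ Ty.Eqv D D' :=
  h.handle_inv_aux rfl

/-! ### Weakening at the outer end of the contexts -/

mutual
-- The added variables must be unlimited, since the variable rule requires every unused variable to
-- be so. Applied with `Δ = []` and `Γ = []`, this places a closed value in an arbitrary unlimited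
-- context without renaming it.
theorem ValTy.append {Δ : KCtx} {Γ : Ctx} {V : Val} {A : Ty} :
    ValTy Δ Γ V A → ∀ {Δ' : KCtx} {Γ' : Ctx}, CtxLin (Δ ++ Δ') Γ' .unl →
      ValTy (Δ ++ Δ') (Γ ++ Γ') V A
  | .var hn hA h, Δ', Γ', h' => by
    refine .var ?_ (hA.append Δ') ?_
    · rw [List.getElem?_append_left (List.getElem?_eq_some_iff.1 hn).1, hn]
    · intro m B hm hB
      rcases lt_or_ge m Γ.length with hlt | hge
      · rw [List.getElem?_append_left hlt] at hB
        exact (h m B hm hB).append Δ'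
      · rw [List.getElem?_append_right hge] at hB
        exact h' B (List.mem_of_getElem? hB)
  | .lam h hA hM, Δ', _, h' => .lam (h.append h') (hA.append Δ') (hM.append h')
  | .tlam h hM, Δ', Γ', h' => by
    refine .tlam (h.append h') ?_
    have := hM.append (h'.tshift _)
    simpa [Ctx.tshift] using this
  | .tag h, _, _, h' => .tag (h.append h')
  | .conv h e hB, Δ', _, h' => .conv (h.append h') e (hB.append Δ')
theorem CompTy.append {Δ : KCtx} {Γ : Ctx} {M : Comp} {C : Ty} :
    CompTy Δ Γ M C → ∀ {Δ' : KCtx} {Γ' : Ctx}, CtxLin (Δ ++ Δ') Γ' .unl →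
      CompTy (Δ ++ Δ') (Γ ++ Γ') M C
  | .app hs hV hW, _, _, h' => .app (hs.append h') (hV.append h') (hW.append h')
  | .tapp hV hT, Δ', _, h' => .tapp (hV.append h') (hT.append Δ')
  | .ret hV hE, Δ', _, h' => .ret (hV.append h') (hE.append Δ')
  | .perform e h hE hV, Δ', _, h' => .perform e (h.append Δ') (hE.append Δ') (hV.append h')
  | .bind hs hM hN h hR, Δ', _, h' =>
    .bind (hs.append h') (hM.append h') (hN.append h') (h.append h') (hR.append Δ')
  | .handle hs hH hM, _, _, h' => .handle (hs.append h') (hH.append h') (hM.append h')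
  | .conv h e hD, Δ', _, h' => .conv (h.append h') e (hD.append Δ')
theorem HndTy.append {Δ : KCtx} {Γ : Ctx} {H : Hnd} {C D : Ty} :
    HndTy Δ Γ H C D → ∀ {Δ' : KCtx} {Γ' : Ctx}, CtxLin (Δ ++ Δ') Γ' .unl →
      HndTy (Δ ++ Δ') (Γ ++ Γ') H C D
  | .handler h hC hD hH, Δ', _, h' =>
    .handler (h.append h') (hC.append Δ') (hD.append Δ') (hH.append h')
theorem ClausesTy.append {Δ : KCtx} {Γ : Ctx} {H : Hnd} {A : Ty}
    {sigs : List (Label × Lin × Ty × Ty)} {D : Ty} :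
    ClausesTy Δ Γ H A sigs D → ∀ {Δ' : KCtx} {Γ' : Ctx}, CtxLin (Δ ++ Δ') Γ' .unl →
      ClausesTy (Δ ++ Δ') (Γ ++ Γ') H A sigs D
  | .ret h, _, _, h' => .ret (h.append h')
  | .op h hH, _, _, h' => .op (h.append h') (hH.append h')
end

/-! ### Renamings and substitutions fix closed terms -/

theorem upVal_var : upVal Val.var = Val.var := by
  funext n; cases n <;> rfl

theorem tupVal_var : tupVal Val.var = Val.var := rfl

theorem upVal_eq_var {σ : ℕ → Val} {k : ℕ} (h : ∀ n < k, σ n = .var n) :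
    ∀ n < k + 1, upVal σ n = .var n := by
  rintro (_ | n) hn
  · rfl
  · rw [upVal, h n (Nat.lt_of_succ_lt_succ hn)]; rfl

theorem tupVal_eq_var {σ : ℕ → Val} {k : ℕ} (h : ∀ n < k, σ n = .var n) :
    ∀ n < k, tupVal σ n = .var n := by
  intro n hn
  rw [tupVal, h n hn]; rfl

theorem upSubst_eq_var {τ : ℕ → Ty} {k : ℕ} (h : ∀ n < k, τ n = .var n) :
    ∀ n < k + 1, Ty.upSubst τ n = .var n := by
  rintro (_ | n) hn
  · rfl
  · rw [Ty.upSubst, h n (Nat.lt_of_succ_lt_succ hn)]; rfl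

mutual
theorem ValTy.subst_eq {Δ : KCtx} {Γ : Ctx} {V : Val} {A : Ty} :
    ValTy Δ Γ V A → ∀ {τ : ℕ → Ty} {σ : ℕ → Val}, (∀ n < Δ.length, τ n = .var n) →
      (∀ n < Γ.length, σ n = .var n) → V.subst τ σ = V
  | .var hn _ _, _, _, _, hσ => hσ _ (List.getElem?_eq_some_iff.1 hn).1
  | .lam _ hA hM, _, _, hτ, hσ => by
    rw [Val.subst, hA.subst_eq hτ, hM.subst_eq hτ (upVal_eq_var hσ)]
  | .tlam _ hM, _, _, hτ, hσ => by
    rw [Val.subst, hM.subst_eq (upSubst_eq_var hτ)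
      (tupVal_eq_var (by simpa [Ctx.tshift] using hσ))]
  | .tag h, _, _, hτ, hσ => by rw [Val.subst, h.subst_eq hτ hσ]
  | .conv h _ _, _, _, hτ, hσ => h.subst_eq hτ hσ
theorem CompTy.subst_eq {Δ : KCtx} {Γ : Ctx} {M : Comp} {C : Ty} :
    CompTy Δ Γ M C → ∀ {τ : ℕ → Ty} {σ : ℕ → Val}, (∀ n < Δ.length, τ n = .var n) →
      (∀ n < Γ.length, σ n = .var n) → M.subst τ σ = M
  | .app hs hV hW, _, _, hτ, hσ => by
    rw [Comp.subst, hV.subst_eq hτ (hs.length.1 ▸ hσ), hW.subst_eq hτ (hs.length.2 ▸ hσ)]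
  | .tapp hV hT, _, _, hτ, hσ => by rw [Comp.subst, hV.subst_eq hτ hσ, hT.subst_eq hτ]
  | .ret hV hE, _, _, hτ, hσ => by rw [Comp.subst, hV.subst_eq hτ hσ, hE.subst_eq hτ]
  | .perform _ _ hE hV, _, _, hτ, hσ => by rw [Comp.subst, hV.subst_eq hτ hσ, hE.subst_eq hτ]
  | .bind hs hM hN _ _, _, _, hτ, hσ => by
    rw [Comp.subst, hM.subst_eq hτ (hs.length.1 ▸ hσ),
      hN.subst_eq hτ (upVal_eq_var (hs.length.2 ▸ hσ))]
  | .handle hs hH hM, _, _, hτ, hσ => by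
    rw [Comp.subst, hM.subst_eq hτ (hs.length.2 ▸ hσ), hH.subst_eq hτ (hs.length.1 ▸ hσ)]
  | .conv h _ _, _, _, hτ, hσ => h.subst_eq hτ hσ
theorem HndTy.subst_eq {Δ : KCtx} {Γ : Ctx} {H : Hnd} {C D : Ty} :
    HndTy Δ Γ H C D → ∀ {τ : ℕ → Ty} {σ : ℕ → Val}, (∀ n < Δ.length, τ n = .var n) →
      (∀ n < Γ.length, σ n = .var n) → H.subst τ σ = H
  | .handler _ _ _ hH, _, _, hτ, hσ => hH.subst_eq hτ hσ
theorem ClausesTy.subst_eq {Δ : KCtx} {Γ : Ctx} {H : Hnd} {A : Ty}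
    {sigs : List (Label × Lin × Ty × Ty)} {D : Ty} :
    ClausesTy Δ Γ H A sigs D → ∀ {τ : ℕ → Ty} {σ : ℕ → Val}, (∀ n < Δ.length, τ n = .var n) →
      (∀ n < Γ.length, σ n = .var n) → H.subst τ σ = H
  | .ret h, _, _, hτ, hσ => by rw [Hnd.subst, h.subst_eq hτ (upVal_eq_var hσ)]
  | .op h hH, _, _, hτ, hσ => by
    rw [Hnd.subst, h.subst_eq hτ (upVal_eq_var (upVal_eq_var hσ)), hH.subst_eq hτ hσ]
end

-- Renaming as a special case of substitution.

theorem upVal_var_comp (ξ : ℕ → ℕ) :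
    upVal (fun n => .var (ξ n)) = fun n => Val.var (upRen ξ n) := by
  funext n; cases n <;> rfl

theorem upSubst_var_comp (ξ : ℕ → ℕ) :
    Ty.upSubst (fun n => .var (ξ n)) = fun n => Ty.var (upRen ξ n) := by
  funext n; cases n <;> rfl

theorem tupVal_var_comp (ξ : ℕ → ℕ) :
    tupVal (fun n => .var (ξ n)) = fun n => Val.var (ξ n) := rfl

mutual
theorem Val.rename_eq_subst (ζ ξ : ℕ → ℕ) : ∀ V : Val,
    V.rename ζ ξ = V.subst (fun n => .var (ζ n)) (fun n => .var (ξ n))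
  | .var n => rfl
  | .lam Y A M => by
    rw [Val.rename, Val.subst, Comp.rename_eq_subst, Ty.rename_eq_subst, upVal_var_comp]
  | .tlam Y K M => by
    rw [Val.rename, Val.subst, Comp.rename_eq_subst, upSubst_var_comp, tupVal_var_comp]
  | .tag V => by rw [Val.rename, Val.subst, Val.rename_eq_subst]
theorem Comp.rename_eq_subst (ζ ξ : ℕ → ℕ) : ∀ M : Comp,
    M.rename ζ ξ = M.subst (fun n => .var (ζ n)) (fun n => .var (ξ n))
  | .app V W => by rw [Comp.rename, Comp.subst, V.rename_eq_subst, W.rename_eq_subst]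
  | .tapp V T => by rw [Comp.rename, Comp.subst, V.rename_eq_subst, T.rename_eq_subst]
  | .ret V E => by rw [Comp.rename, Comp.subst, V.rename_eq_subst, E.rename_eq_subst]
  | .perform l V E => by rw [Comp.rename, Comp.subst, V.rename_eq_subst, E.rename_eq_subst]
  | .bind Y M N => by
    rw [Comp.rename, Comp.subst, M.rename_eq_subst, N.rename_eq_subst, upVal_var_comp]
  | .handle M H => by rw [Comp.rename, Comp.subst, M.rename_eq_subst, H.rename_eq_subst]
theorem Hnd.rename_eq_subst (ζ ξ : ℕ → ℕ) : ∀ H : Hnd,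
    H.rename ζ ξ = H.subst (fun n => .var (ζ n)) (fun n => .var (ξ n))
  | .ret M => by rw [Hnd.rename, Hnd.subst, M.rename_eq_subst, upVal_var_comp]
  | .op l M H => by
    rw [Hnd.rename, Hnd.subst, M.rename_eq_subst, H.rename_eq_subst, upVal_var_comp,
      upVal_var_comp]
end

theorem ValTy.subst_closed {V : Val} {A : Ty} (h : ValTy [] [] V A) (τ : ℕ → Ty) (σ : ℕ → Val) :
    V.subst τ σ = V :=
  h.subst_eq (fun _ h => nomatch h) (fun _ h => nomatch h)

theorem ValTy.rename_closed {V : Val} {A : Ty} (h : ValTy [] [] V A) (ζ ξ : ℕ → ℕ) :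
    V.rename ζ ξ = V := by
  rw [Val.rename_eq_subst, h.subst_closed]

/-! ### Substitution of types in typing derivations -/

theorem Ctx.subst_tshift (τ : ℕ → Ty) (Γ : Ctx) :
    (Ctx.tshift Γ).map (Option.map (Ty.subst (Ty.upSubst τ))) =
      Ctx.tshift (Γ.map (Option.map (Ty.subst τ))) := by
  simp only [Ctx.tshift, List.map_map]
  refine List.map_congr_left fun A _ => ?_
  cases A with
  | none => rfl
  | some A => exact congrArg some (Ty.subst_upSubst_shift A τ)

theorem CtxLin.subst {Δ Δ' : KCtx} {Γ : Ctx} {Y : Lin} (h : CtxLin Δ Γ Y) {τ : ℕ → Ty}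
    (hτ : Kinding.Subst Δ Δ' τ) : CtxLin Δ' (Γ.map (Option.map (Ty.subst τ))) Y := by
  intro A hA
  obtain ⟨B, hB, hBA⟩ := List.mem_map.1 hA
  cases B with
  | none => cases hBA
  | some B => cases hBA; exact (h B hB).subst hτ

mutual
theorem ValTy.tsubst {Δ : KCtx} {Γ : Ctx} {V : Val} {A : Ty} :
    ValTy Δ Γ V A → ∀ {Δ' : KCtx} {τ : ℕ → Ty}, Kinding.Subst Δ Δ' τ →
      ValTy Δ' (Γ.map (Option.map (Ty.subst τ))) (V.subst τ .var) (A.subst τ)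
  | .var hn hA h, _, τ, hτ => by
    refine .var (by rw [List.getElem?_map, hn]; rfl) (hA.subst hτ) ?_
    intro m B hm hB
    rw [List.getElem?_map] at hB
    match hG : Γ[m]?, hB with
    | some (some B'), hB => cases hB; exact (h m B' hm hG).subst hτ
  | .lam h hA hM, _, _, hτ => by
    rw [Val.subst, upVal_var]
    exact .lam (h.subst hτ) (hA.subst hτ) (hM.tsubst hτ)
  | .tlam h hM, _, _, hτ => by
    rw [Val.subst, tupVal_var]
    refine .tlam (h.subst hτ) ?_
    rw [← Ctx.subst_tshift]
    exact hM.tsubst (hτ.up _)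
  | .tag h, _, _, hτ => .tag (h.tsubst hτ)
  | .conv h e hB, _, τ, hτ => .conv (h.tsubst hτ) (e.subst τ) (hB.subst hτ)
theorem CompTy.tsubst {Δ : KCtx} {Γ : Ctx} {M : Comp} {C : Ty} :
    CompTy Δ Γ M C → ∀ {Δ' : KCtx} {τ : ℕ → Ty}, Kinding.Subst Δ Δ' τ →
      CompTy Δ' (Γ.map (Option.map (Ty.subst τ))) (M.subst τ .var) (C.subst τ)
  | .app hs hV hW, _, _, hτ => .app (hs.subst hτ) (hV.tsubst hτ) (hW.tsubst hτ)
  | .tapp hV hT, _, τ, hτ => by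
    rw [Ty.inst_subst]
    exact .tapp (hV.tsubst hτ) (hT.subst hτ)
  | .ret hV hE, _, _, hτ => .ret (hV.tsubst hτ) (hE.subst hτ)
  | .perform e h hE hV, _, τ, hτ =>
    .perform (e.subst τ) (h.subst hτ) (hE.subst hτ) (hV.tsubst hτ)
  | .bind hs hM hN h hR, _, _, hτ => by
    rw [Comp.subst, upVal_var]
    exact .bind (hs.subst hτ) (hM.tsubst hτ) (hN.tsubst hτ) (h.subst hτ) (hR.subst hτ)
  | .handle hs hH hM, _, _, hτ => .handle (hs.subst hτ) (hH.tsubst hτ) (hM.tsubst hτ)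
  | .conv h e hD, _, τ, hτ => .conv (h.tsubst hτ) (e.subst τ) (hD.subst hτ)
theorem HndTy.tsubst {Δ : KCtx} {Γ : Ctx} {H : Hnd} {C D : Ty} :
    HndTy Δ Γ H C D → ∀ {Δ' : KCtx} {τ : ℕ → Ty}, Kinding.Subst Δ Δ' τ →
      HndTy Δ' (Γ.map (Option.map (Ty.subst τ))) (H.subst τ .var) (C.subst τ) (D.subst τ)
  | .handler (sigs := sigs) (P := P) (R := R) h hC hD hH, _, τ, hτ => by
    have hC := hC.subst hτ
    have hD := hD.subst hτ
    have hH := hH.tsubst hτ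
    simp only [Ty.subst, Ty.subst_opsRow, Ty.subst_presRow] at hC hD hH ⊢
    exact .handler (h.subst hτ) hC hD hH
theorem ClausesTy.tsubst {Δ : KCtx} {Γ : Ctx} {H : Hnd} {A : Ty}
    {sigs : List (Label × Lin × Ty × Ty)} {D : Ty} :
    ClausesTy Δ Γ H A sigs D → ∀ {Δ' : KCtx} {τ : ℕ → Ty}, Kinding.Subst Δ Δ' τ →
      ClausesTy Δ' (Γ.map (Option.map (Ty.subst τ))) (H.subst τ .var) (A.subst τ)
        (Ty.substSigs τ sigs) (D.subst τ)
  | .ret h, _, _, hτ => by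
    rw [Hnd.subst, upVal_var]
    exact .ret (h.tsubst hτ)
  | .op h hH, _, _, hτ => by
    rw [Hnd.subst, upVal_var, upVal_var]
    exact .op (h.tsubst hτ) (hH.tsubst hτ)
end

/-! ### A structural form of the safety conditions -/

mutual
/-- Tags are attached to closed values without unlimited type, and no tagged value occurs in an
unlimited abstraction, in a handler or, provided that `c` holds, in the continuation of an
unlimited sequencing. -/
def Val.Good (c : Prop) : Val → Prop
  | .var _ => True
  | .lam Y _ M => (Y = .unl → M.tl = 0) ∧ M.Good c
  | .tlam Y _ M => (Y = .unl → M.tl = 0) ∧ M.Good c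
  | .tag V => (∃ A, ValTy [] [] V A) ∧
      (∀ Δ Γ A, ValTy Δ Γ V A → ¬ Kinding Δ A (.type .unl)) ∧ V.Good c
/-- See `Val.Good`. -/
def Comp.Good (c : Prop) : Comp → Prop
  | .app V W => V.Good c ∧ W.Good c
  | .tapp V _ => V.Good c
  | .ret V _ => V.Good c
  | .perform _ V _ => V.Good c
  | .bind Y M N => (c → Y = .unl → N.tl = 0) ∧ M.Good c ∧ N.Good c
  | .handle M H => M.Good c ∧ H.Good c
/-- See `Val.Good`. -/
def Hnd.Good (c : Prop) : Hnd → Prop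
  | .ret M => M.tl = 0 ∧ M.Good c
  | .op _ M H => M.tl = 0 ∧ M.Good c ∧ H.Good c
end

theorem Hnd.Good.tl_eq_zero {c : Prop} : ∀ {H : Hnd}, H.Good c → H.tl = 0
  | .ret _, h => h.1
  | .op _ _ H, h => by rw [Hnd.tl, h.1, Hnd.Good.tl_eq_zero (H := H) h.2.2, add_zero]

-- Unlimited types and the tagging of closed values.

theorem not_unl_of_lin {Δ : KCtx} {A C : Ty} : ¬ Kinding Δ (.arrow .lin A C) (.type .unl) := by
  intro h
  obtain ⟨⟨_, hK, hY⟩, -⟩ := h.arrow_inv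
  cases hK; cases hY

theorem not_unl_of_lin_all {Δ : KCtx} {K : Kind} {C : Ty} :
    ¬ Kinding Δ (.all .lin K C) (.type .unl) := by
  intro h
  obtain ⟨⟨_, hK, hY⟩, -⟩ := h.all_inv
  cases hK; cases hY

/-- Conversion keeps the annotation of the arrow, and an arrow annotated `lin` is never of unlimited
kind. So unlimitedness is a property of the term, independent of the chosen typing. -/
theorem ValTy.lam_unl {Δ Δ' : KCtx} {Γ Γ' : Ctx} {Y : Lin} {A B B' : Ty} {M : Comp}
    (h : ValTy Δ Γ (.lam Y A M) B) (hB : Kinding Δ B (.type .unl))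
    (h' : ValTy Δ' Γ' (.lam Y A M) B') : Y = .unl ∧ Kinding Δ' B' (.type .unl) := by
  obtain ⟨C, e, -⟩ := h.lam_inv
  obtain ⟨_, _, rfl, -⟩ := e.arrow_inv
  obtain ⟨C', e', -⟩ := h'.lam_inv
  obtain ⟨_, _, rfl, -⟩ := e'.arrow_inv
  cases Y
  · exact ⟨rfl, .arrow h'.kinding.arrow_inv.2.1 h'.kinding.arrow_inv.2.2⟩
  · exact absurd hB not_unl_of_lin

theorem ValTy.tlam_unl {Δ Δ' : KCtx} {Γ Γ' : Ctx} {Y : Lin} {K : Kind} {B B' : Ty} {M : Comp}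
    (h : ValTy Δ Γ (.tlam Y K M) B) (hB : Kinding Δ B (.type .unl))
    (h' : ValTy Δ' Γ' (.tlam Y K M) B') : Y = .unl ∧ Kinding Δ' B' (.type .unl) := by
  obtain ⟨C, e, -⟩ := h.tlam_inv
  obtain ⟨_, rfl, -⟩ := e.all_inv
  obtain ⟨C', e', -⟩ := h'.tlam_inv
  obtain ⟨_, rfl, -⟩ := e'.all_inv
  cases Y
  · exact ⟨rfl, .all h'.kinding.all_inv.2⟩
  · exact absurd hB not_unl_of_lin_all

/-- A value of unlimited type is a variable, an abstraction annotated `unl` or a tagged value;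
`Good` excludes the last and makes the second tag-free. -/
theorem Val.Good.tl_eq_zero {c : Prop} {Δ : KCtx} {Γ : Ctx} {V : Val} {A : Ty} (hV : V.Good c)
    (h : ValTy Δ Γ V A) (hA : Kinding Δ A (.type .unl)) : V.tl = 0 := by
  cases V with
  | var n => rfl
  | lam Y B M => exact hV.1 (h.lam_unl hA h).1
  | tlam Y K M => exact hV.1 (h.tlam_unl hA h).1
  | tag V => exact absurd hA (hV.2.1 _ _ _ h.tag_inv)

/-- Closed values: having an unlimited type does not depend on the type or the contexts. -/
theorem ValTy.unl_of_unl {V : Val} {A : Ty} (h : ValTy [] [] V A) {Δ : KCtx} {Γ : Ctx} {B : Ty}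
    (h' : ValTy Δ Γ V B) (hB : Kinding Δ B (.type .unl)) (hV : ∀ W, V ≠ .tag W) :
    Kinding [] A (.type .unl) := by
  cases V with
  | var n => obtain ⟨_, h⟩ := h.var_inv; cases h
  | lam Y B M => exact (h'.lam_unl hB h).2
  | tlam Y K M => exact (h'.tlam_unl hB h).2
  | tag V => exact absurd rfl (hV V)

/-- A tag is added only to a value with some non-unlimited type, and for a closed untagged value
this excludes unlimited types altogether. The marked value therefore still satisfies what
`ClosedSubst` demands. -/
theorem Val.mark_spec {c : Prop} {V : Val} {A : Ty} (h : ValTy [] [] V A) (hV : V.Good c) :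
    ValTy [] [] V.mark.1 A ∧ V.mark.1.tl = V.tl + V.mark.2 ∧
      (Kinding [] A (.type .unl) → V.mark.1.tl = 0) ∧ V.mark.1.Good c := by
  rw [Val.mark]
  split_ifs with hm
  · obtain ⟨⟨B, hB, hn⟩, ht⟩ := hm
    refine ⟨h.tag, add_comm _ _, fun hA => ?_, ⟨_, h⟩, fun Δ Γ A' h' hA' => ?_, hV⟩
    · exact absurd (hB.unl_of_unl h hA ht) hn
    · exact hn (hB.unl_of_unl h' hA' ht)
  · exact ⟨h, (add_zero _).symm, hV.tl_eq_zero h, hV⟩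

/-! ### Relation with linear safety -/

/-- The part of the safety conditions that concerns the root of a term. -/
def Term.LocallySafe (c : Prop) : Term → Prop
  | .val W => (W.IsUnl → W.tl = 0) ∧ ∀ V, W = .tag V → ∃ A, ValTy [] [] V A
  | .comp M => c → ∀ N₁ N₂, M = .bind .unl N₁ N₂ → N₂.tl = 0
  | .hnd H => H.tl = 0

/-- `Val.Good`, `Comp.Good` and `Hnd.Good` taken together. -/
def Term.Good (c : Prop) : Term → Prop
  | .val V => V.Good c
  | .comp M => M.Good c
  | .hnd H => H.Good c

mutual
-- The safety conditions quantify over all subterms, so they can be collected by recursion on the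
-- term, each constructor using the local condition at its root.
theorem Val.good_of_locallySafe {c : Prop} : ∀ {V : Val},
    (∀ s, Term.Sub s (.val V) → s.LocallySafe c) → V.Good c
  | .var _, _ => trivial
  | .lam Y A M, h =>
    ⟨fun hY => (h _ .refl).1 (.inl ⟨A, M, by rw [hY]⟩),
      Comp.good_of_locallySafe fun s hs => h s (.tail hs .lam)⟩
  | .tlam Y K M, h =>
    ⟨fun hY => (h _ .refl).1 (.inr (.inl ⟨K, M, by rw [hY]⟩)),
      Comp.good_of_locallySafe fun s hs => h s (.tail hs .tlam)⟩
  | .tag V, h => by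
    refine ⟨(h _ .refl).2 V rfl, fun Δ Γ A hA hK => ?_,
      Val.good_of_locallySafe fun s hs => h s (.tail hs .tag)⟩
    -- An unlimited type of `V` would also type `.tag V`, whose multiset would then be empty
    -- although it contains `.tag V` itself.
    have := (h _ .refl).1 (.inr (.inr ⟨Δ, Γ, A, hA.tag, hK⟩))
    simp [Val.tl] at this
theorem Comp.good_of_locallySafe {c : Prop} : ∀ {M : Comp},
    (∀ s, Term.Sub s (.comp M) → s.LocallySafe c) → M.Good c
  | .app V W, h => ⟨Val.good_of_locallySafe fun s hs => h s (.tail hs .app_left),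
      Val.good_of_locallySafe fun s hs => h s (.tail hs .app_right)⟩
  | .tapp V T, h => Val.good_of_locallySafe (V := V) fun s hs => h s (.tail hs .tapp)
  | .ret V E, h => Val.good_of_locallySafe (V := V) fun s hs => h s (.tail hs .ret)
  | .perform l V E, h => Val.good_of_locallySafe (V := V) fun s hs => h s (.tail hs .perform)
  | .bind Y M N, h =>
    ⟨fun hc hY => h _ .refl hc M N (by rw [hY]),
      Comp.good_of_locallySafe fun s hs => h s (.tail hs .bind_left),
      Comp.good_of_locallySafe fun s hs => h s (.tail hs .bind_right)⟩
  | .handle _ _, h => ⟨Comp.good_of_locallySafe fun s hs => h s (.tail hs .handle_left),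
      Hnd.good_of_locallySafe fun s hs => h s (.tail hs .handle_right)⟩
theorem Hnd.good_of_locallySafe {c : Prop} : ∀ {H : Hnd},
    (∀ s, Term.Sub s (.hnd H) → s.LocallySafe c) → H.Good c
  | .ret _, h => ⟨h _ .refl, Comp.good_of_locallySafe fun s hs => h s (.tail hs .hret)⟩
  | .op _ _ _, h => ⟨(add_eq_zero.1 (h _ .refl)).1,
      Comp.good_of_locallySafe fun s hs => h s (.tail hs .hop),
      Hnd.good_of_locallySafe fun s hs => h s (.tail hs .hrest)⟩
end

theorem Term.Good.locallySafe {c : Prop} {t : Term} (h : t.Good c) : t.LocallySafe c := by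
  cases t with
  | val W =>
    refine ⟨?_, fun V hV => by subst hV; exact h.1⟩
    rintro (⟨A, N, rfl⟩ | ⟨K, N, rfl⟩ | ⟨Δ, Γ, A, hW, hA⟩)
    · exact h.1 rfl
    · exact h.1 rfl
    · exact Val.Good.tl_eq_zero h hW hA
  | comp M => rintro hc N₁ N₂ rfl; exact h.1 hc rfl
  | hnd H => exact Hnd.Good.tl_eq_zero h

theorem Term.Good.child {c : Prop} {s t : Term} (h : t.Good c) (hs : Term.Child s t) :
    s.Good c := by
  cases hs with
  | lam => exact h.2
  | tlam => exact h.2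
  | tag => exact h.2.2
  | app_left => exact h.1
  | app_right => exact h.2
  | tapp => exact h
  | ret => exact h
  | perform => exact h
  | bind_left => exact h.2.1
  | bind_right => exact h.2.2
  | handle_left => exact h.1
  | handle_right => exact h.2
  | hret => exact h.2
  | hop => exact h.2.1
  | hrest => exact h.2.2

theorem Term.Good.sub {c : Prop} {s t : Term} (h : t.Good c) (hs : Term.Sub s t) : s.Good c := by
  induction hs with
  | refl => exact h
  | tail _ hc ih => exact ih (h.child hc)

theorem Comp.good_of_safe {c : Prop} {M : Comp} (ht : M.TagsClosed) (hv : M.UnlimitedValuesSafe)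
    (hh : M.HandlersSafe) (hl : c → M.UnlimitedLetsSafe) : M.Good c := by
  refine Comp.good_of_locallySafe fun s hs => ?_
  cases s with
  | val W => exact ⟨hv W hs, fun V hV => ht V (hV ▸ hs)⟩
  | comp N => exact fun hc N₁ N₂ hN => hl hc N₁ N₂ (hN ▸ hs)
  | hnd H => exact hh H hs

theorem Comp.Good.tagsClosed {c : Prop} {M : Comp} (h : M.Good c) : M.TagsClosed :=
  fun V hV => (Term.Good.sub (t := .comp M) h hV).locallySafe.2 V rfl

theorem Comp.Good.unlimitedValuesSafe {c : Prop} {M : Comp} (h : M.Good c) :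
    M.UnlimitedValuesSafe :=
  fun _ hW => (Term.Good.sub (t := .comp M) h hW).locallySafe.1

theorem Comp.Good.handlersSafe {c : Prop} {M : Comp} (h : M.Good c) : M.HandlersSafe :=
  fun _ hH => (Term.Good.sub (t := .comp M) h hH).locallySafe

theorem Comp.Good.unlimitedLetsSafe {M : Comp} (h : M.Good True) : M.UnlimitedLetsSafe :=
  fun N₁ N₂ hN => (Term.Good.sub (t := .comp M) h hN).locallySafe trivial N₁ N₂ rfl

/-! ### Substitution of types preserves tagged values -/

mutual
-- The multiset records tagged values as terms, so equality, not just equal cardinality, is at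
-- stake. It holds because tagged values are closed and thus fixed by the substitution.
theorem Val.Good.tsubst {c : Prop} : ∀ {V : Val}, V.Good c → ∀ τ : ℕ → Ty,
    (V.subst τ .var).tl = V.tl ∧ (V.subst τ .var).Good c
  | .var _, _, _ => ⟨rfl, trivial⟩
  | .lam Y A M, h, τ => by
    have ih := Comp.Good.tsubst h.2 τ
    rw [Val.subst, upVal_var, Val.tl, Val.tl, Val.Good, ih.1]
    exact ⟨rfl, h.1, ih.2⟩
  | .tlam Y K M, h, τ => by
    have ih := Comp.Good.tsubst h.2 (Ty.upSubst τ)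
    rw [Val.subst, tupVal_var, Val.tl, Val.tl, Val.Good, ih.1]
    exact ⟨rfl, h.1, ih.2⟩
  | .tag V, h, τ => by
    obtain ⟨A, hA⟩ := h.1
    rw [Val.subst, hA.subst_closed]
    exact ⟨rfl, h⟩
theorem Comp.Good.tsubst {c : Prop} : ∀ {M : Comp}, M.Good c → ∀ τ : ℕ → Ty,
    (M.subst τ .var).tl = M.tl ∧ (M.subst τ .var).Good c
  | .app V W, h, τ => by
    have ih₁ := Val.Good.tsubst h.1 τ
    have ih₂ := Val.Good.tsubst h.2 τ
    rw [Comp.subst, Comp.tl, Comp.tl, ih₁.1, ih₂.1]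
    exact ⟨rfl, ih₁.2, ih₂.2⟩
  | .tapp V T, h, τ => Val.Good.tsubst (V := V) h τ
  | .ret V E, h, τ => Val.Good.tsubst (V := V) h τ
  | .perform l V E, h, τ => Val.Good.tsubst (V := V) h τ
  | .bind Y M N, h, τ => by
    have ih₁ := Comp.Good.tsubst h.2.1 τ
    have ih₂ := Comp.Good.tsubst h.2.2 τ
    rw [Comp.subst, upVal_var, Comp.tl, Comp.tl, Comp.Good, ih₁.1, ih₂.1]
    exact ⟨rfl, h.1, ih₁.2, ih₂.2⟩
  | .handle M H, h, τ => by
    have ih₁ := Comp.Good.tsubst h.1 τ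
    have ih₂ := Hnd.Good.tsubst h.2 τ
    rw [Comp.subst, Comp.tl, Comp.tl, ih₁.1, ih₂.1]
    exact ⟨rfl, ih₁.2, ih₂.2⟩
theorem Hnd.Good.tsubst {c : Prop} : ∀ {H : Hnd}, H.Good c → ∀ τ : ℕ → Ty,
    (H.subst τ .var).tl = H.tl ∧ (H.subst τ .var).Good c
  | .ret M, h, τ => by
    have ih := Comp.Good.tsubst h.2 τ
    rw [Hnd.subst, upVal_var, Hnd.tl, Hnd.tl, Hnd.Good, ih.1]
    exact ⟨rfl, h.1, ih.2⟩
  | .op l M H, h, τ => by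
    have ih₁ := Comp.Good.tsubst h.2.1 τ
    have ih₂ := Hnd.Good.tsubst h.2.2 τ
    rw [Hnd.subst, upVal_var, upVal_var, Hnd.tl, Hnd.tl, Hnd.Good, ih₁.1, ih₂.1]
    exact ⟨rfl, h.1, ih₁.2, ih₂.2⟩
end

/-! ### The tagged values in a context of values -/

/-- The tagged values occurring in the values that `σ` assigns to the variables of `Γ`. -/
def Ctx.tl : Ctx → (ℕ → Val) → Multiset Val
  | [], _ => 0
  | none :: Γ, σ => Ctx.tl Γ fun n => σ (n + 1)
  | some _ :: Γ, σ => (σ 0).tl + Ctx.tl Γ fun n => σ (n + 1)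

namespace Ctx

theorem tl_eq_zero {Γ : Ctx} {σ : ℕ → Val}
    (h : ∀ n A, Γ[n]? = some (some A) → (σ n).tl = 0) : Ctx.tl Γ σ = 0 := by
  induction Γ generalizing σ with
  | nil => rfl
  | cons A Γ ih =>
    have ih : Ctx.tl Γ (fun n => σ (n + 1)) = 0 := ih fun n A hA => h (n + 1) A hA
    cases A with
    | none => exact ih
    | some A => rw [Ctx.tl, ih, h 0 A rfl, add_zero]

theorem tl_eq_single {Γ : Ctx} {σ : ℕ → Val} {n : ℕ} {A : Ty} (hn : Γ[n]? = some (some A))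
    (h : ∀ m B, m ≠ n → Γ[m]? = some (some B) → (σ m).tl = 0) : Ctx.tl Γ σ = (σ n).tl := by
  induction Γ generalizing σ n with
  | nil => cases hn
  | cons B Γ ih =>
    cases n with
    | zero =>
      cases hn
      rw [Ctx.tl, tl_eq_zero fun m B hB => h (m + 1) B (Nat.succ_ne_zero m) hB, add_zero]
    | succ n =>
      have ih : Ctx.tl Γ (fun n => σ (n + 1)) = _ :=
        ih hn fun m B hm hB => h (m + 1) B (fun e => hm (Nat.succ.inj e)) hB
      cases B with
      | none => exact ih
      | some B => rw [Ctx.tl, ih, h 0 B (Nat.succ_ne_zero n).symm rfl, zero_add]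

theorem tl_congr {Γ : Ctx} {σ σ' : ℕ → Val}
    (h : ∀ n A, Γ[n]? = some (some A) → (σ n).tl = (σ' n).tl) : Ctx.tl Γ σ = Ctx.tl Γ σ' := by
  induction Γ generalizing σ σ' with
  | nil => rfl
  | cons A Γ ih =>
    have ih : Ctx.tl Γ (fun n => σ (n + 1)) = Ctx.tl Γ (fun n => σ' (n + 1)) :=
      ih fun n A hA => h (n + 1) A hA
    cases A with
    | none => exact ih
    | some A => rw [Ctx.tl, Ctx.tl, ih, h 0 A rfl]

theorem tl_tshift (Γ : Ctx) (σ : ℕ → Val) : Ctx.tl (Ctx.tshift Γ) σ = Ctx.tl Γ σ := by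
  induction Γ generalizing σ with
  | nil => rfl
  | cons A Γ ih =>
    cases A with
    | none => exact ih _
    | some A => exact congrArg _ (ih _)

/-- A linear variable is counted on exactly one side. An unlimited one is counted on both,
harmlessly, since by hypothesis its value has no tags. -/
theorem tl_split {Δ : KCtx} {Γ Γ₁ Γ₂ : Ctx} (hs : Split Δ Γ Γ₁ Γ₂) {σ : ℕ → Val}
    (h : ∀ n A, Γ[n]? = some (some A) → Kinding Δ A (.type .unl) → (σ n).tl = 0) :
    Ctx.tl Γ σ = Ctx.tl Γ₁ σ + Ctx.tl Γ₂ σ := by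
  induction hs generalizing σ with
  | nil => rfl
  | none _ ih => exact ih fun n A => h (n + 1) A
  | unl hA _ ih =>
    rw [Ctx.tl, Ctx.tl, Ctx.tl, ih fun n A => h (n + 1) A, h 0 _ rfl hA, zero_add, zero_add,
      zero_add]
  | linLeft hA _ ih => rw [Ctx.tl, Ctx.tl, Ctx.tl, ih fun n A => h (n + 1) A, add_assoc]
  | linRight hA _ ih => rw [Ctx.tl, Ctx.tl, Ctx.tl, ih fun n A => h (n + 1) A, add_left_comm]

end Ctx

/-! ### Substitution of closed values -/

/-- Without type variables only the two value type formers remain, and both display their linearity.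
-/
theorem Kinding.closed_type {A : Ty} {Y : Lin} (h : Kinding [] A (.type Y)) :
    (∃ Y' B C, A = .arrow Y' B C) ∨ ∃ Y' K C, A = .all Y' K C := by
  generalize hΔ : ([] : KCtx) = Δ at h
  generalize hK : Kind.type Y = K at h
  induction h generalizing Y with
  | var hn => subst hΔ; cases hn
  | arrow => exact .inl ⟨_, _, _, rfl⟩
  | all => exact .inr ⟨_, _, _, rfl⟩
  | upcast _ hs ih => subst hK; cases hs; exact ih hΔ rfl
  | _ => cases hK

/-- For closed types, being unlimited is independent of the kind context. -/
theorem Kinding.unl_strengthen {Δ : KCtx} {A : Ty} (h : Kinding [] A (.type .lin))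
    (h' : Kinding Δ A (.type .unl)) : Kinding [] A (.type .unl) := by
  rcases h.closed_type with ⟨Y, B, C, rfl⟩ | ⟨Y, K, C, rfl⟩
  · cases Y
    · exact .arrow h.arrow_inv.2.1 h.arrow_inv.2.2
    · exact absurd h' not_unl_of_lin
  · cases Y
    · exact .all h.all_inv.2
    · exact absurd h' not_unl_of_lin_all

/-- `σ` maps the variables `n ≥ k` of `Γ` to good closed values and fixes all variables `n < k`. -/
structure ClosedSubst (c : Prop) (Γ : Ctx) (k : ℕ) (σ : ℕ → Val) : Prop where
  low : ∀ n < k, σ n = .var n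
  high : ∀ n A, k ≤ n → Γ[n]? = some (some A) →
    ValTy [] [] (σ n) A ∧ (Kinding [] A (.type .unl) → (σ n).tl = 0) ∧ (σ n).Good c

namespace ClosedSubst

variable {c : Prop} {Γ : Ctx} {k : ℕ} {σ : ℕ → Val}

theorem tl_eq_zero (h : ClosedSubst c Γ k σ) {n : ℕ} {A : Ty} (hn : Γ[n]? = some (some A))
    {Δ : KCtx} (hA : Kinding Δ A (.type .unl)) : (σ n).tl = 0 := by
  rcases lt_or_ge n k with hk | hk
  · rw [h.low n hk]; rfl
  · obtain ⟨h₁, h₂, -⟩ := h.high n A hk hn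
    exact h₂ (h₁.kinding.unl_strengthen hA)

theorem good (h : ClosedSubst c Γ k σ) {n : ℕ} {A : Ty} (hn : Γ[n]? = some (some A)) :
    (σ n).Good c := by
  rcases lt_or_ge n k with hk | hk
  · rw [h.low n hk]; exact trivial
  · exact (h.high n A hk hn).2.2

theorem tl_rename (h : ClosedSubst c Γ k σ) {n : ℕ} {A : Ty} (hn : Γ[n]? = some (some A))
    (ζ ξ : ℕ → ℕ) : ((σ n).rename ζ ξ).tl = (σ n).tl := by
  rcases lt_or_ge n k with hk | hk
  · rw [h.low n hk]; rfl
  · rw [(h.high n A hk hn).1.rename_closed]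

theorem mono (h : ClosedSubst c Γ k σ) {Γ' : Ctx}
    (hΓ : ∀ (n : ℕ) (A : Ty), Γ'[n]? = some (some A) → Γ[n]? = some (some A)) :
    ClosedSubst c Γ' k σ :=
  ⟨h.low, fun n A hk hn => h.high n A hk (hΓ n A hn)⟩

theorem left (h : ClosedSubst c Γ k σ) {Δ : KCtx} {Γ₁ Γ₂ : Ctx} (hs : Split Δ Γ Γ₁ Γ₂) :
    ClosedSubst c Γ₁ k σ := h.mono fun _ _ => hs.get_left

theorem right (h : ClosedSubst c Γ k σ) {Δ : KCtx} {Γ₁ Γ₂ : Ctx} (hs : Split Δ Γ Γ₁ Γ₂) :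
    ClosedSubst c Γ₂ k σ := h.mono fun _ _ => hs.get_right

/-- Closed values are unchanged by weakening, so passing a binder only raises the threshold `k`. -/
theorem up (h : ClosedSubst c Γ k σ) (A : Option Ty) :
    ClosedSubst c (A :: Γ) (k + 1) (upVal σ) := by
  refine ⟨upVal_eq_var h.low, ?_⟩
  rintro (_ | n) B hk hn
  · cases hk
  · have := h.high n B (Nat.le_of_succ_le_succ hk) hn
    rwa [upVal, this.1.rename_closed]

/-- The types of closed values are closed as well, so shifting the context leaves the entries from
`k` onwards as they are. -/
theorem tup (h : ClosedSubst c Γ k σ) : ClosedSubst c (Ctx.tshift Γ) k (tupVal σ) := by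
  refine ⟨tupVal_eq_var h.low, fun n B hk hn => ?_⟩
  rw [Ctx.tshift, List.getElem?_map] at hn
  match hG : Γ[n]?, hn with
  | some (some B'), hn =>
    cases hn
    have := h.high n B' hk hG
    rwa [tupVal, this.1.rename_closed, this.1.kinding.rename_eq fun _ h => nomatch h]

theorem ctx_tl_up (h : ClosedSubst c Γ k σ) (A : Ty) :
    Ctx.tl (some A :: Γ) (upVal σ) = Ctx.tl Γ σ := by
  rw [Ctx.tl, upVal, Val.tl, zero_add]
  exact Ctx.tl_congr fun n B hB => h.tl_rename hB _ _

theorem ctx_tl_tup (h : ClosedSubst c Γ k σ) :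
    Ctx.tl (Ctx.tshift Γ) (tupVal σ) = Ctx.tl Γ σ := by
  rw [Ctx.tl_tshift]
  exact Ctx.tl_congr fun n B hB => h.tl_rename hB _ _

theorem ctx_tl_split (h : ClosedSubst c Γ k σ) {Δ : KCtx} {Γ₁ Γ₂ : Ctx}
    (hs : Split Δ Γ Γ₁ Γ₂) : Ctx.tl Γ σ = Ctx.tl Γ₁ σ + Ctx.tl Γ₂ σ :=
  Ctx.tl_split hs fun _ _ hn hA => h.tl_eq_zero hn hA

theorem ctx_tl_eq_zero (h : ClosedSubst c Γ k σ) {Δ : KCtx} (hΓ : CtxLin Δ Γ .unl) :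
    Ctx.tl Γ σ = 0 :=
  Ctx.tl_eq_zero fun _ A hn => h.tl_eq_zero hn (hΓ A (List.mem_of_getElem? hn))

end ClosedSubst

mutual
-- The accounting principle. Only the first `k` entries of `Γ` survive as the context of the result;
-- the others have been replaced by closed values. The typing half does not need `Good`, the
-- counting half does.
theorem ValTy.closedSubst {c : Prop} {Δ : KCtx} {Γ : Ctx} {V : Val} {A : Ty} :
    ValTy Δ Γ V A → ∀ {k : ℕ} {σ : ℕ → Val}, ClosedSubst c Γ k σ →
      ValTy Δ (Γ.take k) (V.subst .var σ) A ∧ (V.Good c →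
        (V.subst .var σ).tl = V.tl + Ctx.tl Γ σ ∧ (V.subst .var σ).Good c)
  | .var (n := n) hn hA h, k, σ, hσ => by
    refine ⟨?_, fun _ => ⟨?_, hσ.good hn⟩⟩
    · rw [Val.subst]
      rcases lt_or_ge n k with hk | hk
      · rw [hσ.low n hk]
        refine .var (by rw [List.getElem?_take_of_lt hk, hn]) hA fun m B hm hB => h m B hm ?_
        rw [List.getElem?_take] at hB
        split_ifs at hB
        exact hB
      -- The closed value is weakened by `Γ.take k`. Entries there have indices below `k ≤ n`, hence
      -- differ from `n`, and are unlimited by the variable rule.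
      · refine (hσ.high n _ hk hn).1.append (Δ' := Δ) (Γ' := Γ.take k) fun B hB => ?_
        obtain ⟨m, hm⟩ := List.mem_iff_getElem?.1 hB
        rw [List.getElem?_take] at hm
        split_ifs at hm with hmk
        exact h m B (by omega) hm
    · rw [Val.subst, Val.tl, zero_add, Ctx.tl_eq_single hn]
      exact fun m B hm hB => hσ.tl_eq_zero hB (h m B hm hB)
  | .lam h hA hM, k, σ, hσ => by
    have ih := hM.closedSubst (hσ.up _)
    rw [hσ.ctx_tl_up] at ih
    rw [Val.subst, Ty.subst_var]
    refine ⟨.lam (h.take k) hA ih.1, fun hg => ⟨(ih.2 hg.2).1, ?_, (ih.2 hg.2).2⟩⟩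
    -- An abstraction annotated `unl` is typed in an unlimited context, so `σ` brings no tags into
    -- its body.
    rintro rfl
    rw [(ih.2 hg.2).1, hg.1 rfl, hσ.ctx_tl_eq_zero h, add_zero]
  | .tlam h hM, k, σ, hσ => by
    have ih := hM.closedSubst hσ.tup
    rw [hσ.ctx_tl_tup, Ctx.tshift, ← List.map_take] at ih
    rw [Val.subst, Ty.upSubst_var]
    refine ⟨.tlam (h.take k) ih.1, fun hg => ⟨(ih.2 hg.2).1, ?_, (ih.2 hg.2).2⟩⟩
    rintro rfl
    rw [(ih.2 hg.2).1, hg.1 rfl, hσ.ctx_tl_eq_zero h, add_zero]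
  | .tag h, _, _, hσ => by
    have ih := h.closedSubst hσ
    refine ⟨.tag ih.1, fun hg => ?_⟩
    obtain ⟨A, hA⟩ := hg.1
    have ih := ih.2 hg.2.2
    rw [Val.subst]
    rw [hA.subst_closed] at ih ⊢
    -- As `V` is closed, substitution fixes it, so the induction hypothesis reads `V.tl = V.tl +
    -- Ctx.tl Γ σ`; cancelling shows that `σ` contributes nothing.
    rw [left_eq_add.1 ih.1, add_zero]
    exact ⟨rfl, hg⟩
  | .conv h e hB, _, _, hσ => ⟨.conv (h.closedSubst hσ).1 e hB, (h.closedSubst hσ).2⟩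
theorem CompTy.closedSubst {c : Prop} {Δ : KCtx} {Γ : Ctx} {M : Comp} {C : Ty} :
    CompTy Δ Γ M C → ∀ {k : ℕ} {σ : ℕ → Val}, ClosedSubst c Γ k σ →
      CompTy Δ (Γ.take k) (M.subst .var σ) C ∧ (M.Good c →
        (M.subst .var σ).tl = M.tl + Ctx.tl Γ σ ∧ (M.subst .var σ).Good c)
  | .app hs hV hW, k, _, hσ => by
    have ih₁ := hV.closedSubst (hσ.left hs)
    have ih₂ := hW.closedSubst (hσ.right hs)
    refine ⟨.app (hs.take k) ih₁.1 ih₂.1, fun hg => ⟨?_, (ih₁.2 hg.1).2, (ih₂.2 hg.2).2⟩⟩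
    rw [Comp.subst, Comp.tl, Comp.tl, (ih₁.2 hg.1).1, (ih₂.2 hg.2).1, hσ.ctx_tl_split hs,
      add_add_add_comm]
  | .tapp hV hT, _, _, hσ => by
    have ih := hV.closedSubst hσ
    rw [Comp.subst, Ty.subst_var]
    exact ⟨.tapp ih.1 hT, ih.2⟩
  | .ret hV hE, _, _, hσ => by
    have ih := hV.closedSubst hσ
    rw [Comp.subst, Ty.subst_var]
    exact ⟨.ret ih.1 hE, ih.2⟩
  | .perform e h hE hV, _, _, hσ => by
    have ih := hV.closedSubst hσ
    rw [Comp.subst, Ty.subst_var]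
    exact ⟨.perform e h hE ih.1, ih.2⟩
  | .bind hs hM hN h hR, k, _, hσ => by
    have ih₁ := hM.closedSubst (hσ.left hs)
    have ih₂ := hN.closedSubst ((hσ.right hs).up _)
    rw [(hσ.right hs).ctx_tl_up] at ih₂
    refine ⟨.bind (hs.take k) ih₁.1 ih₂.1 (h.take k) hR,
      fun hg => ⟨?_, ?_, (ih₁.2 hg.2.1).2, (ih₂.2 hg.2.2).2⟩⟩
    · rw [Comp.subst, Comp.tl, Comp.tl, (ih₁.2 hg.2.1).1, (ih₂.2 hg.2.2).1, hσ.ctx_tl_split hs,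
        add_add_add_comm]
    · rintro hc rfl
      rw [(ih₂.2 hg.2.2).1, hg.1 hc rfl, (hσ.right hs).ctx_tl_eq_zero h, add_zero]
  | .handle hs hH hM, k, _, hσ => by
    have ih₁ := hH.closedSubst (hσ.left hs)
    have ih₂ := hM.closedSubst (hσ.right hs)
    refine ⟨.handle (hs.take k) ih₁.1 ih₂.1, fun hg => ⟨?_, (ih₂.2 hg.1).2, (ih₁.2 hg.2).2⟩⟩
    rw [Comp.subst, Comp.tl, Comp.tl, (ih₁.2 hg.2).1, (ih₂.2 hg.1).1, hσ.ctx_tl_split hs,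
      add_comm (Ctx.tl _ _), add_add_add_comm]
  | .conv h e hD, _, _, hσ => ⟨.conv (h.closedSubst hσ).1 e hD, (h.closedSubst hσ).2⟩
theorem HndTy.closedSubst {c : Prop} {Δ : KCtx} {Γ : Ctx} {H : Hnd} {C D : Ty} :
    HndTy Δ Γ H C D → ∀ {k : ℕ} {σ : ℕ → Val}, ClosedSubst c Γ k σ →
      HndTy Δ (Γ.take k) (H.subst .var σ) C D ∧ (H.Good c →
        (H.subst .var σ).tl = H.tl + Ctx.tl Γ σ ∧ (H.subst .var σ).Good c)
  | .handler h hC hD hH, k, _, hσ => by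
    have hz := hσ.ctx_tl_eq_zero h
    have ih := hH.closedSubst hσ
    refine ⟨.handler (h.take k) hC hD ih.1, fun hg => ?_⟩
    have ih := ih.2 hz hg
    rw [ih.tl_eq_zero, hg.tl_eq_zero, hz]
    exact ⟨rfl, ih⟩
-- All clauses share the same `Γ`, so an additive count would overcount; the hypothesis `Ctx.tl Γ σ
-- = 0` is supplied by the unlimited context of a handler.
theorem ClausesTy.closedSubst {c : Prop} {Δ : KCtx} {Γ : Ctx} {H : Hnd} {A : Ty}
    {sigs : List (Label × Lin × Ty × Ty)} {D : Ty} :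
    ClausesTy Δ Γ H A sigs D → ∀ {k : ℕ} {σ : ℕ → Val}, ClosedSubst c Γ k σ →
      ClausesTy Δ (Γ.take k) (H.subst .var σ) A sigs D ∧ (Ctx.tl Γ σ = 0 → H.Good c →
        (H.subst .var σ).Good c)
  | .ret h, _, _, hσ => by
    have ih := h.closedSubst (hσ.up _)
    rw [hσ.ctx_tl_up] at ih
    refine ⟨.ret ih.1, fun hz hg => ⟨?_, (ih.2 hg.2).2⟩⟩
    rw [(ih.2 hg.2).1, hg.1, hz, add_zero]
  | .op h hH, _, _, hσ => by
    have ih₁ := h.closedSubst ((hσ.up _).up _)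
    have ih₂ := hH.closedSubst hσ
    rw [(hσ.up _).ctx_tl_up, hσ.ctx_tl_up] at ih₁
    refine ⟨.op ih₁.1 ih₂.1, fun hz hg => ⟨?_, (ih₁.2 hg.2.1).2, ih₂.2 hz hg.2.2⟩⟩
    rw [(ih₁.2 hg.2.1).1, hg.1, hz, add_zero]
end

-- Instantiation of one or two variables by marked values.

theorem ClosedSubst.single {c : Prop} {V : Val} {A : Ty} (h : ValTy [] [] V A)
    (hA : Kinding [] A (.type .unl) → V.tl = 0) (hV : V.Good c) :
    ClosedSubst c [some A] 0 (single V) := by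
  refine ⟨fun _ h => (nomatch h), ?_⟩
  rintro (_ | n) B - hn
  · cases hn; exact ⟨h, hA, hV⟩
  · cases hn

theorem ClosedSubst.double {c : Prop} {V W : Val} {A B : Ty} (hV : ValTy [] [] V A)
    (hA : Kinding [] A (.type .unl) → V.tl = 0) (hVg : V.Good c) (hW : ValTy [] [] W B)
    (hB : Kinding [] B (.type .unl) → W.tl = 0) (hWg : W.Good c) :
    ClosedSubst c [some B, some A] 0 (double V W) := by
  refine ⟨fun _ h => (nomatch h), ?_⟩
  rintro (_ | _ | n) B - hn
  · cases hn; exact ⟨hW, hB, hWg⟩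
  · cases hn; exact ⟨hV, hA, hVg⟩
  · cases hn

/-- Substitution of the marked form of a closed value. -/
theorem CompTy.inst_mark {c : Prop} {M : Comp} {V : Val} {A C : Ty}
    (hM : CompTy [] [some A] M C) (hMg : M.Good c) (hV : ValTy [] [] V A) (hVg : V.Good c) :
    CompTy [] [] (M.inst V.mark.1) C ∧ (M.inst V.mark.1).tl = M.tl + (V.tl + V.mark.2) ∧
      (M.inst V.mark.1).Good c := by
  obtain ⟨h₁, h₂, h₃, h₄⟩ := Val.mark_spec hV hVg
  have h := hM.closedSubst (.single h₁ h₃ h₄)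
  refine ⟨h.1, (h.2 hMg).1.trans ?_, (h.2 hMg).2⟩
  rw [Ctx.tl, Ctx.tl, add_zero, FEff.single, h₂]

theorem CompTy.inst₂_mark {c : Prop} {M : Comp} {V W : Val} {A B C : Ty}
    (hM : CompTy [] [some B, some A] M C) (hMg : M.Good c) (hV : ValTy [] [] V A)
    (hVg : V.Good c) (hW : ValTy [] [] W B) (hWg : W.Good c) :
    CompTy [] [] (M.inst₂ V.mark.1 W.mark.1) C ∧
      (M.inst₂ V.mark.1 W.mark.1).tl = M.tl + ((W.tl + W.mark.2) + (V.tl + V.mark.2)) ∧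
      (M.inst₂ V.mark.1 W.mark.1).Good c := by
  obtain ⟨h₁, h₂, h₃, h₄⟩ := Val.mark_spec hV hVg
  obtain ⟨k₁, k₂, k₃, k₄⟩ := Val.mark_spec hW hWg
  have h := hM.closedSubst (.double h₁ h₃ h₄ k₁ k₃ k₄)
  refine ⟨h.1, (h.2 hMg).1.trans ?_, (h.2 hMg).2⟩
  rw [Ctx.tl, Ctx.tl, Ctx.tl, add_zero, double, double, h₂, k₂]

/-! ### Clauses of handlers -/

theorem ClausesTy.retBody {Δ : KCtx} {Γ : Ctx} {H : Hnd} {A : Ty}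
    {sigs : List (Label × Lin × Ty × Ty)} {D : Ty} :
    ClausesTy Δ Γ H A sigs D → CompTy Δ (some A :: Γ) H.retBody D
  | .ret h => h
  | .op _ h => h.retBody

theorem Hnd.Good.retBody {c : Prop} : ∀ {H : Hnd}, H.Good c →
    H.retBody.tl = 0 ∧ H.retBody.Good c
  | .ret _, h => h
  | .op _ _ H, h => Hnd.Good.retBody (H := H) h.2.2

theorem ClausesTy.clause {Δ : KCtx} {Γ : Ctx} {H : Hnd} {A : Ty}
    {sigs : List (Label × Lin × Ty × Ty)} {D : Ty} :
    ClausesTy Δ Γ H A sigs D → ∀ {l : Label} {N : Comp}, H.HasClause l N →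
      ∃ Y A' B', (l, Y, A', B') ∈ sigs ∧ CompTy Δ (some (.arrow Y B' D) :: some A' :: Γ) N D
  | .ret _, _, _, h => h.elim
  | .op h hH, _, _, h' => by
    rcases h' with ⟨rfl, rfl⟩ | h'
    · exact ⟨_, _, _, List.mem_cons_self, h⟩
    · obtain ⟨_, _, _, hm, h⟩ := hH.clause h'
      exact ⟨_, _, _, List.mem_cons_of_mem _ hm, h⟩

theorem Hnd.Good.clause {c : Prop} : ∀ {H : Hnd}, H.Good c → ∀ {l : Label} {N : Comp},
    H.HasClause l N → N.tl = 0 ∧ N.Good c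
  | .ret _, _, _, _, h => h.elim
  | .op _ _ H, h, _, _, h' => by
    rcases h' with ⟨rfl, rfl⟩ | h'
    · exact ⟨h.1, h.2.1⟩
    · exact Hnd.Good.clause (H := H) h.2.2 h'

theorem ClausesTy.labels_subset_dom {Δ : KCtx} {Γ : Ctx} {H : Hnd} {A : Ty}
    {sigs : List (Label × Lin × Ty × Ty)} {D : Ty} :
    ClausesTy Δ Γ H A sigs D → ∀ {l : Label}, l ∈ sigs.map Prod.fst → l ∈ H.dom
  | .ret _, _, h => nomatch h
  | .op _ hH, _, h => by
    rcases List.mem_cons.1 h with rfl | h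
    · exact Finset.mem_insert_self _ _
    · exact Finset.mem_insert_of_mem (hH.labels_subset_dom h)

/-! ### Evaluation contexts -/

theorem Split.self_none {Δ : KCtx} {Γ : Ctx} (h : CtxLin Δ Γ .lin) :
    Split Δ Γ Γ (Γ.map fun _ => Option.none) ∧ Split Δ Γ (Γ.map fun _ => Option.none) Γ := by
  induction Γ with
  | nil => exact ⟨.nil, .nil⟩
  | cons A Γ ih =>
    have ih := ih fun B hB => h B (List.mem_cons_of_mem _ hB)
    cases A with
    | none => exact ⟨.none ih.1, .none ih.2⟩
    | some A => exact ⟨.linLeft (h A List.mem_cons_self) ih.1,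
        .linRight (h A List.mem_cons_self) ih.2⟩

theorem CtxLin.map_none {Δ : KCtx} (Γ : Ctx) {Y : Lin} :
    CtxLin Δ (Γ.map fun _ => none) Y := by
  intro A hA
  obtain ⟨_, -, h⟩ := List.mem_map.1 hA
  cases h

namespace ECtx

theorem tl_plug (𝓔 : ECtx) (M : Comp) : (𝓔.plug M).tl = 𝓔.tl + M.tl := by
  induction 𝓔 with
  | hole => exact (zero_add _).symm
  | bind Y 𝓔 N ih => rw [plug, Comp.tl, ih, ECtx.tl, add_right_comm]
  | handle 𝓔 H ih => rw [plug, Comp.tl, ih, ECtx.tl, add_right_comm]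

theorem sub_plug (𝓔 : ECtx) (M : Comp) : Term.Sub (.comp M) (.comp (𝓔.plug M)) := by
  induction 𝓔 with
  | hole => exact .refl
  | bind Y 𝓔 N ih => exact .tail ih .bind_left
  | handle 𝓔 H ih => exact .tail ih .handle_left

/-- The conditions on a `let` or a handler frame never constrain the computation being evaluated, so
the filling of the hole can be exchanged. -/
theorem good_plug {c : Prop} {𝓔 : ECtx} {M : Comp} (h : (𝓔.plug M).Good c) :
    M.Good c ∧ ∀ N : Comp, N.Good c → (𝓔.plug N).Good c := by
  induction 𝓔 with
  | hole => exact ⟨h, fun _ h => h⟩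
  | bind Y 𝓔 N ih => exact ⟨(ih h.2.1).1, fun N' hN => ⟨h.1, (ih h.2.1).2 N' hN, h.2.2⟩⟩
  | handle 𝓔 H ih => exact ⟨(ih h.1).1, fun N' hN => ⟨(ih h.1).2 N' hN, h.2⟩⟩

/-- The frames of a closed computation are closed up to the variable that `let` binds, and `upRen`
fixes that one. The weakening in the captured continuation is therefore invisible. -/
theorem shift_eq {𝓔 : ECtx} {M : Comp} {C : Ty} (h : CompTy [] [] (𝓔.plug M) C) :
    𝓔.shift = 𝓔 := by
  induction 𝓔 generalizing C with
  | hole => rfl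
  | bind Y 𝓔 N ih =>
    obtain ⟨_, _, A, B, R, hs, hM, hN, -⟩ := h.bind_inv
    obtain ⟨rfl, rfl⟩ := hs.nil_inv
    rw [shift, ih hM, Comp.rename_eq_subst, hN.subst_eq (fun _ h => nomatch h)]
    rintro (_ | n) hn
    · rfl
    · exact absurd (Nat.lt_of_succ_lt_succ hn) (Nat.not_lt_zero n)
  | handle 𝓔 H ih =>
    obtain ⟨_, _, C, D, hs, hH, hM, -⟩ := h.handle_inv
    obtain ⟨rfl, rfl⟩ := hs.nil_inv
    rw [shift, ih hM, Hnd.rename_eq_subst,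
      hH.subst_eq (fun _ h => nomatch h) (fun _ h => nomatch h)]

/-- Replacement of the closed computation in an evaluation context by an open one. -/
theorem plug_inv {𝓔 : ECtx} {M : Comp} {C : Ty} (h : CompTy [] [] (𝓔.plug M) C) :
    ∃ C', CompTy [] [] M C' ∧ ∀ (Γ : Ctx) (N : Comp), CtxLin [] Γ .lin → CompTy [] Γ N C' →
      CompTy [] Γ (𝓔.plug N) C := by
  induction 𝓔 generalizing C with
  | hole => exact ⟨C, h, fun _ _ _ h => h⟩
  | bind Y 𝓔 N ih =>
    have hC := h.kinding
    obtain ⟨_, _, A, B, R, hs, hM, hN, -, hR, e⟩ := h.bind_inv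
    obtain ⟨rfl, rfl⟩ := hs.nil_inv
    obtain ⟨C', hM, ih⟩ := ih hM
    -- All of `Γ` goes to the hole. The continuation gets a context of `none` entries only, which is
    -- vacuously of every linearity, whatever the annotation `Y`.
    refine ⟨C', hM, fun Γ N' hΓ hN' => .conv (.bind (Split.self_none hΓ).1 (ih Γ N' hΓ hN') ?_
      (.map_none Γ) hR) e hC⟩
    exact hN.append (Δ' := []) (.map_none Γ)
  | handle 𝓔 H ih =>
    have hC := h.kinding
    obtain ⟨_, _, C, D, hs, hH, hM, e⟩ := h.handle_inv
    obtain ⟨rfl, rfl⟩ := hs.nil_inv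
    obtain ⟨C', hM, ih⟩ := ih hM
    refine ⟨C', hM, fun Γ N' hΓ hN' => .conv (.handle (Split.self_none hΓ).2 ?_
      (ih Γ N' hΓ hN')) e hC⟩
    exact hH.append (Δ' := []) (.map_none Γ)

/-- Conversion may reorder the row and change argument and result types up to identification, which
is why these are existential; the linearity `Y` stays the same. -/
theorem hasOp_conv {l : Label} {Y : Lin} {A B C D : Ty} (e : Ty.Eqv D C)
    (h : ∃ A₁ R A' B', D = .comp A₁ (.eff R) ∧ Ty.RowMem l (.op Y A' B') R ∧ Ty.Eqv A A' ∧
      Ty.Eqv B B') :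
    ∃ A₁ R A' B', C = .comp A₁ (.eff R) ∧ Ty.RowMem l (.op Y A' B') R ∧ Ty.Eqv A A' ∧
      Ty.Eqv B B' := by
  obtain ⟨A₁, R, A', B', rfl, hm, hA, hB⟩ := h
  obtain ⟨_, _, rfl, -, e⟩ := e.comp_inv
  obtain ⟨_, rfl, e'⟩ := e.eff_inv
  obtain ⟨A'', B'', hm, hA', hB'⟩ := e'.rowMem hm
  exact ⟨_, _, _, _, rfl, hm, hA.trans hA', hB.trans hB'⟩

/-- An operation that is not handled by an evaluation context occurs in its effect type. -/
theorem hasOp {𝓔 : ECtx} {Δ : KCtx} {Γ : Ctx} {l : Label} {V : Val} {E C : Ty} {Y : Lin}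
    {A B : Ty} (h : CompTy Δ Γ (𝓔.plug (.perform l V E)) C) (hE : E.HasOp l Y A B)
    (hl : l ∉ 𝓔.bl) :
    ∃ A₁ R A' B', C = .comp A₁ (.eff R) ∧ Ty.RowMem l (.op Y A' B') R ∧ Ty.Eqv A A' ∧
      Ty.Eqv B B' := by
  induction 𝓔 generalizing Γ C with
  | hole =>
    obtain ⟨_, _, B₁, _, -, -, -, -, e⟩ := h.perform_inv
    obtain ⟨R, rfl, hm⟩ := hE
    exact hasOp_conv e ⟨_, _, _, _, rfl, hm, .refl _, .refl _⟩
  | bind Y' 𝓔 N ih =>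
    obtain ⟨_, _, _, B₁, R, -, hM, -, -, -, e⟩ := h.bind_inv
    obtain ⟨_, _, A', B', hC, hm, hA, hB⟩ := ih hM hl
    cases hC
    exact hasOp_conv e ⟨_, _, _, _, rfl, hm, hA, hB⟩
  | handle 𝓔 H ih =>
    rw [bl, Finset.mem_union, not_or] at hl
    obtain ⟨_, _, _, _, -, hH, hM, e⟩ := h.handle_inv
    obtain ⟨_, _, A', B', hC, hm, hA, hB⟩ := ih hM hl.1
    cases hH with
    | handler _ _ _ hH =>
      cases hC
      -- The inner handler does not handle `l`, so the entry lies in the shared tail and survives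
      -- into the output row.
      exact hasOp_conv e ⟨_, _, _, _, rfl,
        hm.presRow_of_opsRow fun h => hl.2 (hH.labels_subset_dom h), hA, hB⟩

/-- In a typed computation, the continuation of a control-flow unlimited operation consists of
handlers and of control-flow unlimited sequencings. -/
theorem tl_eq_zero_of_good {𝓔 : ECtx} {Δ : KCtx} {Γ : Ctx} {l : Label} {V : Val} {E C : Ty}
    {A B : Ty} (h : CompTy Δ Γ (𝓔.plug (.perform l V E)) C)
    (hg : (𝓔.plug (.perform l V E)).Good True) (hE : E.HasOp l .unl A B) (hl : l ∉ 𝓔.bl) :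
    𝓔.tl = 0 := by
  induction 𝓔 generalizing Γ C with
  | hole => rfl
  | bind Y 𝓔 N ih =>
    obtain ⟨_, _, _, B₁, R, -, hM, -, -, hR, -⟩ := h.bind_inv
    obtain ⟨_, _, A', B', hC, hm, -⟩ := hasOp hM hE hl
    cases hC
    -- The row has kind `Row^Y` by the typing of `let^Y` and contains a `•`-signature, so `Y ≤ •`
    -- and condition 4 applies.
    obtain ⟨⟨_, hK, hY⟩, -⟩ := (hm.kinding hR).op_inv
    cases hK
    rw [ECtx.tl, ih hM hg.2.1 hl, hg.1 trivial hY.eq_unl, add_zero]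
  | handle 𝓔 H ih =>
    rw [bl, Finset.mem_union, not_or] at hl
    obtain ⟨_, _, _, _, -, hH, hM, e⟩ := h.handle_inv
    rw [ECtx.tl, ih hM hg.1 hl.1, hg.2.tl_eq_zero, add_zero]

end ECtx

/-! ### Subterms of typed terms are typed -/

/-- The term has a type in some contexts. -/
def Term.Typed : Term → Prop
  | .val V => ∃ Δ Γ A, ValTy Δ Γ V A
  | .comp M => ∃ Δ Γ C, CompTy Δ Γ M C
  | .hnd H => ∃ Δ Γ A sigs D, ClausesTy Δ Γ H A sigs D

/-- Condition 2 concerns subterms at any depth, also under binders. Handlers are tracked by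
`ClausesTy`, which, unlike `HndTy`, passes directly to the handler without its first clause. -/
theorem Term.Typed.child {s t : Term} (h : t.Typed) (hs : Term.Child s t) : s.Typed := by
  cases hs with
  | lam => obtain ⟨_, _, _, h⟩ := h; obtain ⟨_, -, -, -, h⟩ := h.lam_inv; exact ⟨_, _, _, h⟩
  | tlam => obtain ⟨_, _, _, h⟩ := h; obtain ⟨_, -, -, h⟩ := h.tlam_inv; exact ⟨_, _, _, h⟩
  | tag => obtain ⟨_, _, _, h⟩ := h; exact ⟨_, _, _, h.tag_inv⟩
  | app_left =>
    obtain ⟨_, _, _, h⟩ := h; obtain ⟨_, _, _, _, _, -, h, -⟩ := h.app_inv; exact ⟨_, _, _, h⟩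
  | app_right =>
    obtain ⟨_, _, _, h⟩ := h; obtain ⟨_, _, _, _, _, -, -, h, -⟩ := h.app_inv
    exact ⟨_, _, _, h⟩
  | tapp => obtain ⟨_, _, _, h⟩ := h; obtain ⟨_, _, _, h, -⟩ := h.tapp_inv; exact ⟨_, _, _, h⟩
  | ret => obtain ⟨_, _, _, h⟩ := h; obtain ⟨_, h, -⟩ := h.ret_inv; exact ⟨_, _, _, h⟩
  | perform =>
    obtain ⟨_, _, _, h⟩ := h; obtain ⟨_, _, _, _, -, -, -, h, -⟩ := h.perform_inv
    exact ⟨_, _, _, h⟩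
  | bind_left =>
    obtain ⟨_, _, _, h⟩ := h; obtain ⟨_, _, _, _, _, -, h, -⟩ := h.bind_inv; exact ⟨_, _, _, h⟩
  | bind_right =>
    obtain ⟨_, _, _, h⟩ := h; obtain ⟨_, _, _, _, _, -, -, h, -⟩ := h.bind_inv
    exact ⟨_, _, _, h⟩
  | handle_left =>
    obtain ⟨_, _, _, h⟩ := h; obtain ⟨_, _, _, _, -, -, h, -⟩ := h.handle_inv
    exact ⟨_, _, _, h⟩
  | handle_right =>
    obtain ⟨_, _, _, h⟩ := h; obtain ⟨_, _, _, _, -, h, -⟩ := h.handle_inv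
    cases h with | handler _ _ _ h => exact ⟨_, _, _, _, _, h⟩
  | hret => obtain ⟨_, _, _, _, _, h⟩ := h; cases h with | ret h => exact ⟨_, _, _, h⟩
  | hop => obtain ⟨_, _, _, _, _, h⟩ := h; cases h with | op h _ => exact ⟨_, _, _, h⟩
  | hrest => obtain ⟨_, _, _, _, _, h⟩ := h; cases h with | op _ h => exact ⟨_, _, _, _, _, h⟩

theorem Term.Typed.sub {s t : Term} (h : t.Typed) (hs : Term.Sub s t) : s.Typed := by
  induction hs with
  | refl => exact h
  | tail _ hc ih => exact ih (h.child hc)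

/-- Typability and `Good True` both descend to subterms, and there they imply condition 2 outright;
it need not be carried through the reduction. -/
theorem Comp.Good.unlimitedContextsSafe {M : Comp} (h : M.Good True) {Δ : KCtx} {Γ : Ctx} {C : Ty}
    (hM : CompTy Δ Γ M C) : M.UnlimitedContextsSafe := by
  intro 𝓔 l V E A B hs hE hl
  obtain ⟨_, _, _, h'⟩ := Term.Typed.sub (t := .comp M) ⟨_, _, _, hM⟩ hs
  exact ECtx.tl_eq_zero_of_good h' (Term.Good.sub (t := .comp M) h hs) hE hl

/-! ### Reduction -/

/-- Typing and safety of the captured continuation. -/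
theorem CompTy.op_step {c : Prop} {𝓔 : ECtx} {l : Label} {V : Val} {E : Ty} {H : Hnd} {N : Comp}
    {Y : Lin} {A B C : Ty} (h : CompTy [] [] (.handle (𝓔.plug (.perform l V E)) H) C)
    (hg : (Comp.handle (𝓔.plug (.perform l V E)) H).Good c)
    (hu : (Comp.handle (𝓔.plug (.perform l V E)) H).UnlimitedContextsSafe)
    (hl : l ∉ 𝓔.bl) (hN : H.HasClause l N) (hE : E.HasOp l Y A B) :
    ∃ A' K D, CompTy [] [some K, some A'] N D ∧ ValTy [] [] V A' ∧
      ValTy [] [] (.lam Y B (.handle (𝓔.plug (.ret (.var 0) E)) H)) K ∧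
      (Val.lam Y B (.handle (𝓔.plug (.ret (.var 0) E)) H)).Good c ∧ Ty.Eqv D C := by
  obtain ⟨_, _, _, _, hs, hH, hM, eC⟩ := h.handle_inv
  obtain ⟨rfl, rfl⟩ := hs.nil_inv
  obtain ⟨C', hP, hrepl⟩ := ECtx.plug_inv hM
  obtain ⟨Y₁, A₁, B₁, R₁, e, hK, hKE, hV, e'⟩ := hP.perform_inv
  obtain ⟨_, _, A₂, B₂, hC, hm, hA, hB⟩ := ECtx.hasOp hM hE hl
  cases hH with
  | handler hΓ hC₁ hD hcl =>
    cases hC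
    obtain ⟨-, _, hKR⟩ := hC₁.comp_inv.2.2.eff_inv
    obtain ⟨Y₃, A₃, B₃, hsig, hNt⟩ := hcl.clause hN
    -- The entry that the operation leaves in the handled row and the clause's signature have the
    -- same label, so they coincide; in particular the linearity of the clause's resumption is `Y`.
    cases hm.unique (Ty.rowMem_opsRow hsig) hKR
    obtain ⟨-, hA₂, hB₂⟩ := (hm.kinding hKR).op_inv
    obtain ⟨RE, rfl, hmE⟩ := hE
    obtain ⟨_, heq, e⟩ := e.eff_inv
    cases heq
    obtain ⟨-, _, hKE'⟩ := hKE.eff_inv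
    obtain ⟨-, _, hK'⟩ := hK.eff_inv
    obtain ⟨-, -, hKB⟩ := (hmE.kinding hKE').op_inv
    obtain ⟨A₄, B₄, hm₄, hA₄, hB₄⟩ := e.rowMem hmE
    -- The entry chosen in the annotation `E` and the one used to type the operation agree after
    -- identification of rows.
    cases hm₄.unique .here hK'
    obtain ⟨-, -, hKB₁⟩ := (hm₄.kinding hK').op_inv
    have hC' := hP.kinding
    have hΓB : CtxLin [] [some B] .lin := by
      intro T hT
      cases List.mem_singleton.1 hT
      exact hKB
    -- The bound variable has type `B` from the annotation, while the hole expects `B₁`; they are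
    -- identified by `hB₄`.
    have hret : CompTy [] [some B] (.ret (.var 0) (.eff RE)) C' := by
      refine .conv (.ret (.conv (.var rfl hKB ?_) hB₄ hKB₁) hKE) e' hC'
      rintro (_ | m) T hm hT
      · exact absurd rfl hm
      · cases hT
    have hH' : HndTy [] [none] H _ _ :=
      (HndTy.handler hΓ hC₁ hD hcl).append (Δ' := []) (Γ' := [none]) (.map_none [none])
    have hW := ValTy.lam (Y := Y) .nil hKB
      (.handle (.linRight hKB .nil) hH' (hrepl _ _ hΓB hret))
    refine ⟨A₂, _, _, hNt, .conv hV (hA₄.symm.trans hA) hA₂,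
      .conv hW (.arrow hB (.refl _)) (.arrow hB₂ hD), ⟨?_, ?_, hg.2⟩, eC⟩
    -- The only use of condition 2: an unlimited continuation must be tag-free, and its tags are
    -- those of `𝓔` and `H`.
    · rintro rfl
      rw [Comp.tl, ECtx.tl_plug, hu 𝓔 l V _ A B (.single .handle_left) ⟨_, rfl, hmE⟩ hl,
        hg.2.tl_eq_zero]
      rfl
    · exact (ECtx.good_plug hg.1).2 _ trivial

/-- Leaving `c` arbitrary lets the same argument serve with and without condition 4. Condition 2 is
assumed for `M` but not concluded for `N`, as it need not survive on its own. -/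
theorem Step.preservation {c : Prop} {M N : Comp} {S T : Multiset Val} (h : Step M S T N) {C : Ty}
    (hM : CompTy [] [] M C) (hg : M.Good c) (hu : M.UnlimitedContextsSafe) :
    M.tl + S = N.tl + T ∧ CompTy [] [] N C ∧ N.Good c := by
  induction h generalizing C with
  | app =>
    have hC := hM.kinding
    obtain ⟨_, _, Y, A, C', hs, hF, hV, e⟩ := hM.app_inv
    obtain ⟨rfl, rfl⟩ := hs.nil_inv
    obtain ⟨C'', e', -, hA, hM⟩ := hF.lam_inv
    obtain ⟨_, _, h, hA', hC'⟩ := e'.arrow_inv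
    cases h
    obtain ⟨h₁, h₂, h₃⟩ := hM.inst_mark hg.1.2 (.conv hV hA'.symm hA) hg.2
    refine ⟨?_, .conv h₁ (hC'.trans e) hC, h₃⟩
    rw [h₂, add_zero, ← add_assoc]; rfl
  | tapp =>
    have hC := hM.kinding
    obtain ⟨Y, K, C', hV, hT, e⟩ := hM.tapp_inv
    obtain ⟨C'', e', -, hM⟩ := hV.tlam_inv
    obtain ⟨_, h, hC'⟩ := e'.all_inv
    cases h
    obtain ⟨h₁, h₂⟩ := Comp.Good.tsubst hg.2 (Ty.single _)
    exact ⟨congrArg (· + 0) h₁.symm,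
      .conv (hM.tsubst (.single hT)) ((hC'.subst _).trans e) hC, h₂⟩
  | seq =>
    have hC := hM.kinding
    obtain ⟨_, _, A, B, R, hs, hV, hN, -, -, e⟩ := hM.bind_inv
    obtain ⟨rfl, rfl⟩ := hs.nil_inv
    have hA := hV.kinding.comp_inv.2.1
    obtain ⟨A', hV, -, e'⟩ := hV.ret_inv
    obtain ⟨_, _, h, hA', -⟩ := e'.comp_inv
    cases h
    obtain ⟨h₁, h₂, h₃⟩ := hN.inst_mark hg.2.2 (.conv hV hA' hA) hg.2.1
    refine ⟨?_, .conv h₁ e hC, h₃⟩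
    rw [h₂, add_zero, ← add_assoc, Comp.tl, Comp.tl, add_comm (Val.tl _)]
  | ret =>
    have hC := hM.kinding
    obtain ⟨_, _, _, _, hs, hH, hV, e⟩ := hM.handle_inv
    obtain ⟨rfl, rfl⟩ := hs.nil_inv
    cases hH with
    | handler _ _ _ hH =>
      have hA := hV.kinding.comp_inv.2.1
      obtain ⟨A', hV, -, e'⟩ := hV.ret_inv
      obtain ⟨_, _, h, hA', -⟩ := e'.comp_inv
      cases h
      obtain ⟨hr₁, hr₂⟩ := hg.2.retBody
      obtain ⟨h₁, h₂, h₃⟩ := hH.retBody.inst_mark hr₂ (.conv hV hA' hA) hg.1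
      refine ⟨?_, .conv h₁ e hC, h₃⟩
      -- Handlers have no tags, so discarding the operation clauses loses nothing.
      rw [h₂, hr₁, add_zero, zero_add, Comp.tl, Comp.tl, hg.2.tl_eq_zero, add_zero]
  | op hl hN hE hW =>
    have hC := hM.kinding
    -- The weakenings in the captured continuation act on closed syntax and can be erased.
    have hH : Hnd.rename id Nat.succ _ = _ := (by
      obtain ⟨_, _, _, _, hs, hH, -⟩ := hM.handle_inv
      obtain ⟨rfl, rfl⟩ := hs.nil_inv
      rw [Hnd.rename_eq_subst, hH.subst_eq (fun _ h => nomatch h) (fun _ h => nomatch h)])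
    have hS : ECtx.shift _ = _ := (by
      obtain ⟨_, _, _, _, hs, -, hM, -⟩ := hM.handle_inv
      obtain ⟨rfl, rfl⟩ := hs.nil_inv
      exact ECtx.shift_eq hM)
    rw [hH, hS] at hW
    subst hW
    obtain ⟨A', K, D, hNt, hV, hW, hWg, e⟩ := hM.op_step hg hu hl hN hE
    obtain ⟨hn₁, hn₂⟩ := hg.2.clause hN
    have hVg := (ECtx.good_plug hg.1).1
    obtain ⟨h₁, h₂, h₃⟩ := hNt.inst₂_mark hn₂ hV hVg hW hWg
    refine ⟨?_, .conv h₁ e hC, h₃⟩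
    -- The tags of `𝓔` move into the continuation and those of `V` into the parameter; clause body
    -- and handler contribute none, although the handler is copied.
    rw [h₂, hn₁]
    simp only [Comp.tl, Val.tl, ECtx.tl_plug, hg.2.tl_eq_zero, add_zero, zero_add]
    abel
  | @remove F V =>
    have hC := hM.kinding
    cases F with
    | app W =>
      obtain ⟨_, _, Y, A, C', hs, hF, hV, e⟩ := hM.app_inv
      refine ⟨?_, .conv (.app hs hF.tag_inv hV) e hC, hg.1.2.2, hg.2⟩
      simp only [FCtx.plug, Comp.tl, Val.tl, add_zero]
      abel
    | tapp T =>
      obtain ⟨Y, K, C', hV, hT, e⟩ := hM.tapp_inv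
      exact ⟨(add_zero _).trans (add_comm _ _), .conv (.tapp hV.tag_inv hT) e hC, hg.2.2⟩
  | @lift 𝓔 M S T N _ ih =>
    obtain ⟨C', hM', hrepl⟩ := ECtx.plug_inv hM
    obtain ⟨hg', hgrepl⟩ := ECtx.good_plug hg
    -- Condition 2 is inherited because subterms of `M` are subterms of `𝓔[M]`.
    obtain ⟨h₁, h₂, h₃⟩ := ih hM' hg' fun 𝓔' l V E A B hs =>
      hu 𝓔' l V E A B (hs.trans (ECtx.sub_plug 𝓔 M))
    refine ⟨?_, hrepl [] N .nil h₂, hgrepl N h₃⟩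
    rw [ECtx.tl_plug, ECtx.tl_plug, add_assoc, add_assoc, h₁]

end FEff

-- Reduction safety.

theorem mainTheorem1 (M N : FEff.Comp) (C : FEff.Ty) (S T : Multiset FEff.Val)
    (htyped : FEff.CompTy [] [] M C) (htags : M.TagsClosed) (hsafe : M.LinearSafe)
    (hstep : FEff.Step M S T N) :
    M.tl + S = N.tl + T ∧
    FEff.CompTy [] [] N C ∧ N.TagsClosed ∧
    N.UnlimitedValuesSafe ∧ N.HandlersSafe ∧
    (M.UnlimitedLetsSafe → N.LinearSafe ∧ N.UnlimitedLetsSafe) := by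
  have hgood (c : Prop) (hc : c → M.UnlimitedLetsSafe) : M.Good c :=
    FEff.Comp.good_of_safe htags hsafe.values hsafe.handlers hc
  -- With `c := False` the demand on `let^•` is vacuous, which yields all claims that do not assume
  -- condition 4.
  obtain ⟨htl, hN, hg⟩ := hstep.preservation htyped (hgood False False.elim) hsafe.contexts
  refine ⟨htl, hN, hg.tagsClosed, hg.unlimitedValuesSafe, hg.handlersSafe, fun hlets => ?_⟩
  -- The same step is analysed again with `c := True`, now that condition 4 is available.
  have hg' := (hstep.preservation htyped (hgood True fun _ => hlets) hsafe.contexts).2.2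
  exact ⟨⟨hg.unlimitedValuesSafe, hg'.unlimitedContextsSafe hN, hg.handlersSafe⟩,
    hg'.unlimitedLetsSafe⟩
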